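/- Let $d\ge 2$, $n\in\{0,1,2,\dots\}$ and $\mu>-1$. On the unit ball $\mathbb B^d=\{x\in\mathbb R^d:\|x\|\le 1\}$ let $W_\mu(x)=(1-\|x\|^2)^\mu$, $\langle f,g\rangle_\mu=\int_{\mathbb B^d}f(x)g(x)W_\mu(x)\,dx$ and $\|f\|_{\mu,2}=\langle f,f\rangle_\mu^{1/2}$. Let $\Pi_n^d$ be the space of real polynomials of total degree at most $n$ in $d$ variables, let $\mathcal V_n(W_\mu,\mathbb B^d)$ be the space of those $f\in\Pi_n^d$ with $\langle f,q\rangle_\mu=0$ for all polynomials $q$ of degree less than $n$ (it contains $0$), and let $D_{ij}=x_i\partial_j-x_j\partial_i$. **(1)** For every $f\in\Pi_n^d$, $$\sum_{i=1}^d\Big\|\sqrt{1-\|x\|^2}\,\partial_i f\Big\|_{\mu,2}^2+\sum_{1\le i<j\le d}\|D_{ij}f\|_{\mu,2}^2\le n(n+2\mu+d)\,\|f\|_{\mu,2}^2,$$ with equality if and only if $f\in\mathcal V_n(W_\mu,\mathbb B^d)$. The constant is the smallest possible; in particular, for each $i$ the nonzero polynomial $C_n^{(\mu+d/2)}(x_i)$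 lies in $\mathcal V_n(W_\mu,\mathbb B^d)$ and attains equality, where $C_n^{(\lambda)}$ denotes the Gegenbauer polynomial. **(2)** If $n$ is even, then for every $f\in\Pi_n^d$, $$\sum_{i=1}^d\Big\|\sqrt{1-\|x\|^2}\,\partial_i f\Big\|_{\mu,2}^2\le n(n+2\mu+d)\,\|f\|_{\mu,2}^2 .$$ **(3)** If $n$ is odd, then for every $f\in\Pi_n^d$, $$\sum_{i=1}^d\Big\|\sqrt{1-\|x\|^2}\,\partial_i f\Big\|_{\mu,2}^2\le \big(n(n+2\mu+d)-d+1\big)\,\|f\|_{\mu,2}^2 .$$ Both (2) and (3) are sharp: the constant on the right is the smallest possible. More precisely, let $P_m^{(\alpha,\beta)}$ be the Jacobi polynomials, let $m=\lfloor n/2\rfloor$ and $k=n-2m\in\{0,1\}$. Then for every nonzero homogeneous harmonic polynomial $Y$ of degree $k$ the polynomial $$Q(x)=P_m^{(\mu,\;k+\frac{d-2}{2})}\big(2\|x\|^2-1\big)\,Y(x)$$ is a nonzero element of $\mathcal V_n(W_\mu,\mathbb B^d)$ and attains equality in (2) if $n$ is even and in (3) if $n$ is odd. -/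

import Mathlib

namespace BallBernstein

noncomputable section

/-- The value of a real polynomial in `d` variables at a point of `ℝ^d`. -/
def val {d : ℕ} (f : MvPolynomial (Fin d) ℝ) (x : EuclideanSpace ℝ (Fin d)) : ℝ :=
  MvPolynomial.eval (fun i => x i) f

/-- The space `Π_n^d` of real polynomials of total degree at most `n` in `d` variables. -/
def polySpace (d n : ℕ) : Submodule ℝ (MvPolynomial (Fin d) ℝ) :=
  MvPolynomial.restrictTotalDegree (Fin d) ℝ n

/-- The closed Euclidean unit ball of `ℝ^d`. -/
def unitBall (d : ℕ) : Set (EuclideanSpace ℝ (Fin d)) := Metric.closedBall 0 1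

/-- The weight `W_μ(x) = (1 - ‖x‖²)^μ`. -/
def weight {d : ℕ} (μ : ℝ) (x : EuclideanSpace ℝ (Fin d)) : ℝ := (1 - ‖x‖ ^ 2) ^ μ

/-- The inner product `⟨g, h⟩_μ = ∫ g h W_μ` over the unit ball. -/
def wInner {d : ℕ} (μ : ℝ) (g h : EuclideanSpace ℝ (Fin d) → ℝ) : ℝ :=
  ∫ x in unitBall d, g x * h x * weight μ x

/-- The norm of `L²(W_μ, B^d)`. -/
def wNorm {d : ℕ} (μ : ℝ) (g : EuclideanSpace ℝ (Fin d) → ℝ) : ℝ := √(wInner μ g g)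

/-- For `μ > -1` the weight is integrable over the ball (also when `μ < 0`). -/
theorem integrableOn_weight {d : ℕ} (hd : 2 ≤ d) {μ : ℝ} (hμ : -1 < μ) :
    MeasureTheory.IntegrableOn (weight μ) (unitBall d) := by
  have : Nontrivial (EuclideanSpace ℝ (Fin d)) := by
    refine Module.nontrivial_of_finrank_pos (R := ℝ) ?_
    simp only [finrank_euclideanSpace, Fintype.card_fin]
    omega
  have h1 : IntervalIntegrable (fun y : ℝ => (1 - y) ^ μ) MeasureTheory.volume 0 1 := by
    have h := (intervalIntegral.intervalIntegrable_rpow' (a := 1) (b := 0) hμ).comp_sub_left 1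
    simpa using h
  have h2 : MeasureTheory.IntegrableOn (fun y : ℝ => (1 - y) ^ μ) (Set.Icc 0 1) :=
    (intervalIntegrable_iff_integrableOn_Icc_of_le zero_le_one).1 h1
  have hc : ContinuousOn (fun y : ℝ => y ^ (d - 1) * (1 + y) ^ μ) (Set.Icc 0 1) := by
    refine ContinuousOn.mul (by fun_prop) (ContinuousOn.rpow_const (by fun_prop) ?_)
    intro y hy
    left
    have := hy.1
    positivity
  have h3 := h2.continuousOn_mul hc isCompact_Icc
  have h4 : MeasureTheory.IntegrableOn
      (fun x : EuclideanSpace ℝ (Fin d) => (fun r : ℝ => (1 - r ^ 2) ^ μ) ‖x‖)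
      (Metric.ball 0 1) := by
    refine (MeasureTheory.integrableOn_fun_norm_addHaar MeasureTheory.volume
      (f := fun r : ℝ => (1 - r ^ 2) ^ μ) (r := 1)).2 ?_
    refine (h3.mono_set Set.Ioo_subset_Icc_self).congr_fun ?_ measurableSet_Ioo
    intro y hy
    have e : (1 : ℝ) - y ^ 2 = (1 + y) * (1 - y) := by ring
    simp only [finrank_euclideanSpace, Fintype.card_fin, smul_eq_mul]
    rw [e, Real.mul_rpow (by linarith [hy.1]) (by linarith [hy.2]), mul_assoc]
  refine h4.congr_set_ae ?_
  refine (MeasureTheory.ae_eq_of_subset_of_measure_ge Metric.ball_subset_closedBall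
    (MeasureTheory.Measure.addHaar_closedBall_eq_addHaar_ball _ _ _).le
    measurableSet_ball.nullMeasurableSet MeasureTheory.measure_closedBall_lt_top.ne).symm

/-- For `μ > -1` and continuous `g`, `h` the function `g h W_μ` is integrable over the ball, so that
the integrals in `wInner` and `wNorm` are genuine for all functions considered below. -/
theorem integrableOn_mul_weight {d : ℕ} (hd : 2 ≤ d) {μ : ℝ} (hμ : -1 < μ)
    {g h : EuclideanSpace ℝ (Fin d) → ℝ} (hg : Continuous g) (hh : Continuous h) :
    MeasureTheory.IntegrableOn (fun x => g x * h x * weight μ x) (unitBall d) :=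
  (integrableOn_weight hd hμ).continuousOn_mul (hg.mul hh).continuousOn
    (isCompact_closedBall _ _)

/-- The space `V_n(W_μ, B^d)` of orthogonal polynomials of degree `n`: the polynomials in `Π_n^d`
that are orthogonal to all polynomials of degree less than `n`. -/
def orthoPoly (d n : ℕ) (μ : ℝ) : Set (MvPolynomial (Fin d) ℝ) :=
  {f | f ∈ polySpace d n ∧
    ∀ q : MvPolynomial (Fin d) ℝ, q.totalDegree < n → wInner μ (val f) (val q) = 0}

/-- The angular derivative `D_{ij} f = x_i ∂_j f - x_j ∂_i f`. -/
def angDeriv {d : ℕ} (i j : Fin d) (f : MvPolynomial (Fin d) ℝ) : MvPolynomial (Fin d) ℝ :=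
  MvPolynomial.X i * MvPolynomial.pderiv j f - MvPolynomial.X j * MvPolynomial.pderiv i f

/-- `∑_i ‖√(1 - ‖x‖²) ∂_i f‖²_{μ,2}`. -/
def gradSum {d : ℕ} (μ : ℝ) (f : MvPolynomial (Fin d) ℝ) : ℝ :=
  ∑ i : Fin d, wNorm μ (fun x => √(1 - ‖x‖ ^ 2) * val (MvPolynomial.pderiv i f) x) ^ 2

/-- `∑_{i < j} ‖D_{ij} f‖²_{μ,2}`. -/
def angSum {d : ℕ} (μ : ℝ) (f : MvPolynomial (Fin d) ℝ) : ℝ :=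
  ∑ i : Fin d, ∑ j ∈ Finset.Ioi i, wNorm μ (val (angDeriv i j f)) ^ 2

/-- The Gegenbauer polynomial
`C_n^λ(t) = ∑_{0 ≤ k ≤ n/2} (-1)^k (λ)_{n-k} / (k! (n-2k)!) (2t)^{n-2k}`,
where `(a)_k = a (a+1) ⋯ (a+k-1)`. -/
def gegenbauer (n : ℕ) (lam : ℝ) : Polynomial ℝ :=
  ∑ k ∈ Finset.range (n / 2 + 1),
    Polynomial.C ((-1) ^ k * (ascPochhammer ℝ (n - k)).eval lam /
      ((k.factorial : ℝ) * ((n - 2 * k).factorial : ℝ))) *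
      (2 * Polynomial.X) ^ (n - 2 * k)

/-- The Jacobi polynomial
`P_m^{(α,β)}(t) = ∑_{0 ≤ k ≤ m} (m+α+β+1)_k (α+k+1)_{m-k} / (k! (m-k)!) ((t-1)/2)^k`. -/
def jacobi (m : ℕ) (α β : ℝ) : Polynomial ℝ :=
  ∑ k ∈ Finset.range (m + 1),
    Polynomial.C ((ascPochhammer ℝ k).eval (m + α + β + 1) *
      (ascPochhammer ℝ (m - k)).eval (α + k + 1) /
      ((k.factorial : ℝ) * ((m - k).factorial : ℝ))) *
      (Polynomial.C (1 / 2) * (Polynomial.X - 1)) ^ k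

/-- The space `H_k^d` of (solid) spherical harmonics: homogeneous polynomials of degree `k` in the
kernel of the Laplacian. -/
def sphHarm (d k : ℕ) : Set (MvPolynomial (Fin d) ℝ) :=
  {Y | Y.IsHomogeneous k ∧
    ∑ i : Fin d, MvPolynomial.pderiv i (MvPolynomial.pderiv i Y) = 0}

/-- The polynomial `C_n^{μ+d/2}(x_i)`. -/
def gegenbauerPoly {d : ℕ} (n : ℕ) (μ : ℝ) (i : Fin d) : MvPolynomial (Fin d) ℝ :=
  Polynomial.aeval (MvPolynomial.X i) (gegenbauer n (μ + d / 2))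

/-- The polynomial `P_m^{(μ, k + (d-2)/2)}(2‖x‖² - 1) Y(x)`, for a spherical harmonic `Y` of
degree `k` (here `k + 2m` is the degree of the product). -/
def jacobiHarmonic {d : ℕ} (m k : ℕ) (μ : ℝ) (Y : MvPolynomial (Fin d) ℝ) :
    MvPolynomial (Fin d) ℝ :=
  Polynomial.aeval (2 * ∑ i : Fin d, MvPolynomial.X i ^ 2 - 1)
    (jacobi m μ (k + ((d : ℝ) - 2) / 2)) * Y

end

end BallBernstein

/-!
The two sums are quadratic forms of second order differential operators that are symmetric for
`⟨·,·⟩_μ`. All integrations by parts come from the single identity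
`∫ ∂_i p (1 - ‖x‖²)^(μ+1) = 2 (μ + 1) ∫ x_i p (1 - ‖x‖²)^μ` (`ballInt_pderiv`), which is proved for
all `μ > -1` by integrating along lines: the extension by zero of `p (1 - ‖x‖²)^(μ+1)` is
continuous, and each line meets the sphere in at most two points, so the possible blow-up of its
derivative there does no harm. The identity also makes `∫ D_{ij} p W_μ` vanish, because
`∫ x_i ∂_j p W_μ` is a multiple of `∫ ∂_i ∂_j p W_{μ+1}`, which is symmetric in `i` and `j`.
Hence the first sum is `⟨f, A f⟩` with `A = -(1 - ‖x‖²) Δ + 2 (μ + 1) x · ∇` (`gradOp`) and the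
second is `⟨f, B f⟩` with `B = -∑ D_{ij}² = E² + (d - 2) E - ‖x‖² Δ` (`sphOp`), where `E = x · ∇`.

The sum `T = A + B = E² + (2 μ + d) E - Δ` (`ballOp`) multiplies the leading part of a polynomial of
degree `n` by `λ_n = n (n + 2 μ + d)`, and `λ_n` increases strictly with `n`. Together with the
symmetry of `T`, this identifies `V_n` with the `λ_n`-eigenvectors of `T` in `Π_n`. Splitting
`Π_{n+1} = V_{n+1} ⊕ Π_n` orthogonally and inducting on `n` gives `⟨f, T f⟩ ≤ λ_n ‖f‖²`, with its
case of equality. The bound for even `n` follows since the angular sum is nonnegative.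

For odd `n`, elements of `V_n` are odd polynomials, and an odd polynomial is a sum of eigenvectors
of `B` with eigenvalues `k (k + d - 2)`, `k` odd (`mem_span_sphOp_eigenvectors`). So the angular sum
is at least `(d - 1) ‖f‖²` on `V_n`, which can be subtracted there. On the remaining part in `Π_{n-1}`
the eigenvalue gap `λ_n - λ_{n-1} ≥ d - 1` suffices.

The extremal polynomials are recognised as eigenvectors of `T` of the right degree: on functions of
one coordinate, and on radial multiples of a spherical harmonic, `T` reduces to the Gegenbauer and
the Jacobi differential operator.
-/

namespace BallBernstein

noncomputable section

open MeasureTheory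

/-! ### Integration along lines -/

/-- An integrable directional derivative has integral zero, even if on each line it fails to be the
derivative at countably many points. Integrate `F (x + v) - F x = ∫₀¹ F' (x + t v) dt` over `x` and
use translation invariance. -/
theorem integral_eq_zero_of_hasDerivAt_line_off_countable {E : Type*} [NormedAddCommGroup E]
    [NormedSpace ℝ E] [FiniteDimensional ℝ E] [MeasurableSpace E] [BorelSpace E]
    {ν : Measure E} [ν.IsAddHaarMeasure] {F F' : E → ℝ} (v : E)
    (hc : Continuous F) (hF : Integrable F ν) (hF' : Integrable F' ν)
    (hd : ∀ x, ∃ s : Set ℝ, s.Countable ∧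
      ∀ t ∉ s, HasDerivAt (fun t : ℝ => F (x + t • v)) (F' (x + t • v)) t) :
    ∫ x, F' x ∂ν = 0 := by
  have hmp : MeasurePreserving (fun p : ℝ × E => (p.1, p.2 + p.1 • v))
      ((volume.restrict (Set.Ioc (0 : ℝ) 1)).prod ν)
      ((volume.restrict (Set.Ioc (0 : ℝ) 1)).prod ν) := by
    refine (MeasurePreserving.id _).skew_product (g := fun t x => x + t • v) ?_ ?_
    · exact Continuous.measurable (by fun_prop)
    · exact Filter.Eventually.of_forall fun t => (measurePreserving_add_right ν (t • v)).map_eq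
  have hprod : Integrable (Function.uncurry fun (t : ℝ) (x : E) => F' (x + t • v))
      ((volume.restrict (Set.Ioc (0 : ℝ) 1)).prod ν) := hmp.integrable_comp_of_integrable
    (hF'.comp_snd (volume.restrict (Set.Ioc (0 : ℝ) 1)))
  have hline : ∀ᵐ x ∂ν, ∫ t in Set.Ioc (0 : ℝ) 1, F' (x + t • v) = F (x + v) - F x := by
    filter_upwards [hprod.prod_left_ae] with x hx
    obtain ⟨s, hs, hds⟩ := hd x
    have := integral_eq_of_hasDerivAt_off_countable_of_le
      (fun t : ℝ => F (x + t • v)) (fun t => F' (x + t • v)) zero_le_one hs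
      (by fun_prop) (fun t ht => hds t ht.2)
      ((intervalIntegrable_iff_integrableOn_Ioc_of_le zero_le_one).2 hx)
    simpa [intervalIntegral.integral_of_le] using this
  have h1 : ∫ t in Set.Ioc (0 : ℝ) 1, ∫ x, F' (x + t • v) ∂ν = ∫ x, F' x ∂ν := by
    simp [integral_add_right_eq_self]
  rw [← h1, integral_integral_swap hprod, integral_congr_ae hline,
    integral_sub (hF.comp_add_right v) hF, integral_add_right_eq_self, sub_self]

variable {d : ℕ}

/-! ### Integration by parts on the ball -/

theorem continuous_val (f : MvPolynomial (Fin d) ℝ) : Continuous (val f) := by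
  unfold val
  exact (MvPolynomial.continuous_eval f).comp (by fun_prop)

theorem hasDerivAt_val_line (f : MvPolynomial (Fin d) ℝ) (i : Fin d)
    (x : EuclideanSpace ℝ (Fin d)) (t : ℝ) :
    HasDerivAt (fun t : ℝ => val f (x + t • EuclideanSpace.single i 1))
      (val (MvPolynomial.pderiv i f) (x + t • EuclideanSpace.single i 1)) t := by
  induction f using MvPolynomial.induction_on with
  | C a => simpa [val] using hasDerivAt_const t a
  | add p q hp hq => simpa only [val, map_add] using! hp.add hq
  | mul_X p j hp =>
    have hX : HasDerivAt (fun t : ℝ => (x + t • EuclideanSpace.single i (1 : ℝ)) j)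
        ((EuclideanSpace.single i (1 : ℝ) : EuclideanSpace ℝ (Fin d)) j) t := by
      simpa using ((hasDerivAt_id t).mul_const
        ((EuclideanSpace.single i (1 : ℝ) : EuclideanSpace ℝ (Fin d)) j)).const_add (x j)
    have := hp.mul hX
    refine (this.congr_deriv ?_).congr_of_eventuallyEq (Filter.Eventually.of_forall fun s => ?_)
    · rw [Derivation.leibniz, MvPolynomial.pderiv_X]
      simp only [val, smul_eq_mul, map_add, map_mul, MvPolynomial.eval_X]
      rcases eq_or_ne i j with rfl | h
      · simp; ring
      · simp [h.symm]; ring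
    · simp [val]

theorem norm_sq_line (x : EuclideanSpace ℝ (Fin d)) (i : Fin d) (t : ℝ) :
    ‖x + t • EuclideanSpace.single i (1 : ℝ)‖ ^ 2 = ‖x‖ ^ 2 + 2 * t * x i + t ^ 2 := by
  rw [norm_add_sq_real, inner_smul_right, norm_smul, EuclideanSpace.inner_single_right]
  simp
  ring

/-- Off the unit sphere, the extension by zero of `(1 - ‖x‖²)^(μ+1)` is differentiable along
coordinate lines, with derivative the extension by zero of `-2 (μ + 1) x_i (1 - ‖x‖²)^μ`. -/
theorem hasDerivAt_extended_weight_line {μ : ℝ} (hμ : -1 < μ) (i : Fin d)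
    (x : EuclideanSpace ℝ (Fin d)) (t : ℝ)
    (ht : ‖x + t • EuclideanSpace.single i (1 : ℝ)‖ ≠ 1) :
    HasDerivAt
      (fun t : ℝ => max 0 (1 - ‖x + t • EuclideanSpace.single i (1 : ℝ)‖ ^ 2) ^ (μ + 1))
      ((unitBall d).indicator (fun y => -(2 * (μ + 1)) * (y i * weight μ y))
        (x + t • EuclideanSpace.single i (1 : ℝ))) t := by
  have hcont : Continuous fun t : ℝ => 1 - ‖x + t • EuclideanSpace.single i (1 : ℝ)‖ ^ 2 := by
    fun_prop
  rcases lt_or_gt_of_ne ht with h | h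
  · have hpos : 0 < 1 - ‖x + t • EuclideanSpace.single i (1 : ℝ)‖ ^ 2 := by
      have := norm_nonneg (x + t • EuclideanSpace.single i (1 : ℝ)); nlinarith
    have hs : HasDerivAt (fun t : ℝ => 1 - ‖x + t • EuclideanSpace.single i (1 : ℝ)‖ ^ 2)
        (-2 * (x i + t)) t := by
      simp only [norm_sq_line]
      have := ((((hasDerivAt_id t).const_mul 2).mul_const (x i)).const_add (‖x‖ ^ 2)).add
        (hasDerivAt_pow 2 t) |>.const_sub 1
      refine this.congr_deriv ?_
      simp; ring
    have hr := hs.rpow_const (p := μ + 1) (Or.inl hpos.ne')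
    rw [Set.indicator_of_mem (by simpa [unitBall] using h.le)]
    refine (hr.congr_deriv ?_).congr_of_eventuallyEq ?_
    · simp [weight]; ring
    · filter_upwards [hcont.continuousAt.eventually (lt_mem_nhds hpos)] with s hs
      rw [max_eq_right (le_of_lt hs)]
  · have hneg : 1 - ‖x + t • EuclideanSpace.single i (1 : ℝ)‖ ^ 2 < 0 := by nlinarith
    rw [Set.indicator_of_notMem (by simpa [unitBall] using h)]
    refine (hasDerivAt_const t (0 : ℝ)).congr_of_eventuallyEq ?_
    filter_upwards [hcont.continuousAt.eventually (gt_mem_nhds hneg)] with s hs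
    rw [max_eq_left (le_of_lt hs), Real.zero_rpow (by linarith)]

theorem countable_line_sphere (i : Fin d) (x : EuclideanSpace ℝ (Fin d)) :
    {t : ℝ | ‖x + t • EuclideanSpace.single i (1 : ℝ)‖ = 1}.Countable := by
  refine (Set.toFinite {-x i + √(1 - ‖x‖ ^ 2 + x i ^ 2),
    -x i - √(1 - ‖x‖ ^ 2 + x i ^ 2)}).countable.mono fun t ht => ?_
  have ht1 : ‖x + t • EuclideanSpace.single i (1 : ℝ)‖ = 1 := ht
  have h := norm_sq_line x i t
  rw [ht1] at h
  rw [show 1 - ‖x‖ ^ 2 + x i ^ 2 = (t + x i) ^ 2 by linarith, Real.sqrt_sq_eq_abs]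
  rcases abs_choice (t + x i) with h | h <;> rw [h] <;> simp

/-- This holds on the unit sphere too, where both sides are zero whatever value `0 ^ μ` has. -/
theorem weight_add_one {μ : ℝ} (hμ : -1 < μ) {x : EuclideanSpace ℝ (Fin d)}
    (hx : x ∈ unitBall d) : weight (μ + 1) x = (1 - ‖x‖ ^ 2) * weight μ x := by
  have hx1 : ‖x‖ ≤ 1 := by simpa [unitBall] using hx
  have h0 : 0 ≤ 1 - ‖x‖ ^ 2 := by have := norm_nonneg x; nlinarith
  rcases h0.eq_or_lt with h | h
  · simp [weight, ← h, Real.zero_rpow (show μ + 1 ≠ 0 by linarith)]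
  · rw [weight, Real.rpow_add_one h.ne', mul_comm, weight]

/-- Integration by parts for the weight `W_{μ+1}`, including the range `-1 < μ ≤ 0` in which its
derivative may blow up at the sphere. -/
theorem integral_pderiv_mul_weight (hd : 2 ≤ d) {μ : ℝ} (hμ : -1 < μ) (i : Fin d)
    (f : MvPolynomial (Fin d) ℝ) :
    ∫ x in unitBall d, (1 - ‖x‖ ^ 2) * val (MvPolynomial.pderiv i f) x * weight μ x =
      2 * (μ + 1) * ∫ x in unitBall d, x i * val f x * weight μ x := by
  have hB : MeasurableSet (unitBall d) := measurableSet_closedBall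
  have hi1 : IntegrableOn (fun x => (1 - ‖x‖ ^ 2) * val (MvPolynomial.pderiv i f) x * weight μ x)
      (unitBall d) := integrableOn_mul_weight hd hμ (by fun_prop) (continuous_val _)
  have hi2 : IntegrableOn (fun x => x i * val f x * weight μ x) (unitBall d) :=
    integrableOn_mul_weight hd hμ (by fun_prop) (continuous_val _)
  let F : EuclideanSpace ℝ (Fin d) → ℝ := fun x => val f x * max 0 (1 - ‖x‖ ^ 2) ^ (μ + 1)
  let F' : EuclideanSpace ℝ (Fin d) → ℝ := (unitBall d).indicator fun x =>
    (1 - ‖x‖ ^ 2) * val (MvPolynomial.pderiv i f) x * weight μ x -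
      2 * (μ + 1) * (x i * val f x * weight μ x)
  have hFc : Continuous F := (continuous_val f).mul
    (Continuous.rpow_const (by fun_prop) fun _ => Or.inr (by linarith))
  have hFsupp : ∀ x ∉ unitBall d, F x = 0 := by
    intro x hx
    have hx1 : 1 < ‖x‖ := by simpa [unitBall] using hx
    have : max 0 (1 - ‖x‖ ^ 2) = 0 := max_eq_left (by nlinarith)
    simp [F, this, Real.zero_rpow (show μ + 1 ≠ 0 by linarith)]
  have hF : Integrable F :=
    hFc.integrable_of_hasCompactSupport
      (HasCompactSupport.intro (isCompact_closedBall 0 1) hFsupp)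
  have hF' : Integrable F' := (integrable_indicator_iff hB).2 (hi1.sub (hi2.const_mul _))
  have key := integral_eq_zero_of_hasDerivAt_line_off_countable
    (EuclideanSpace.single i (1 : ℝ)) hFc hF hF' fun x => by
    refine ⟨_, countable_line_sphere i x, fun t ht => ?_⟩
    have := (hasDerivAt_val_line f i x t).mul (hasDerivAt_extended_weight_line hμ i x t ht)
    refine this.congr_deriv ?_
    by_cases hy : x + t • EuclideanSpace.single i (1 : ℝ) ∈ unitBall d
    · have hy1 : ‖x + t • EuclideanSpace.single i (1 : ℝ)‖ ≤ 1 := by simpa [unitBall] using hy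
      have h0 : 0 ≤ 1 - ‖x + t • EuclideanSpace.single i (1 : ℝ)‖ ^ 2 := by
        have := norm_nonneg (x + t • EuclideanSpace.single i (1 : ℝ)); nlinarith
      have hw := weight_add_one hμ hy
      simp only [F', Set.indicator_of_mem hy, max_eq_right h0]
      rw [weight] at hw
      rw [hw]; ring
    · have hy1 : 1 < ‖x + t • EuclideanSpace.single i (1 : ℝ)‖ := by simpa [unitBall] using hy
      have h0 : max 0 (1 - ‖x + t • EuclideanSpace.single i (1 : ℝ)‖ ^ 2) = 0 :=
        max_eq_left (by nlinarith)
      simp only [F', Set.indicator_of_notMem hy, h0,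
        Real.zero_rpow (show μ + 1 ≠ 0 by linarith), mul_zero, add_zero]
  rw [integral_indicator hB, integral_sub hi1 (hi2.const_mul _), integral_const_mul] at key
  linarith

/-! ### The Gegenbauer and Jacobi differential equations -/

section Univariate

open Polynomial

/-- Telescoping for differential operators that map the `k`-th term of a sum to a combination of the
`k`-th monomial and its neighbour. -/
theorem sum_range_succ_telescope {M : Type*} [AddCommGroup M] {N : ℕ} {u v : ℕ → M}
    (hv : v 0 = 0) (hu : u N = 0) (h : ∀ k < N, v (k + 1) = -u k) :
    ∑ k ∈ Finset.range (N + 1), (u k + v k) = 0 := by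
  rw [Finset.sum_add_distrib, Finset.sum_range_succ u, Finset.sum_range_succ' v, hu, hv,
    Finset.sum_congr rfl fun k hk => h k (Finset.mem_range.1 hk), Finset.sum_neg_distrib]
  abel

/-- The Gegenbauer operator on a power of `2 X`. The truncated exponent `a - 2` is harmless: for
`a < 2` its coefficient is zero. -/
theorem gegenbauer_ode_term (N lam : ℝ) (a : ℕ) :
    (1 - X ^ 2) * derivative (derivative ((2 * X : ℝ[X]) ^ a)) -
        C (2 * lam + 1) * X * derivative ((2 * X) ^ a) + C N * (2 * X) ^ a =
      C (4 * (a : ℝ) * (a - 1)) * (2 * X) ^ (a - 2) + C (N - a * (a + 2 * lam)) * (2 * X) ^ a := by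
  have h2 : derivative (2 : ℝ[X]) = 0 := derivative_ofNat 2
  have hC2 : (C (2 : ℝ) : ℝ[X]) = 2 := map_ofNat C 2
  have hC4 : (C (4 : ℝ) : ℝ[X]) = 4 := map_ofNat C 4
  rcases a with _ | _ | a
  · simp
  · simp [h2]; ring
  · simp only [derivative_pow, derivative_mul, h2, derivative_X, Nat.add_sub_cancel, map_add,
      map_sub, map_mul, map_natCast, hC2, hC4, map_one, derivative_natCast, Nat.cast_add,
      Nat.cast_one, derivative_one]
    rw [show a + 1 + 1 - 2 = a by omega, derivative_zero]
    ring

theorem gegenbauer_ode (n : ℕ) (lam : ℝ) :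
    (1 - X ^ 2) * derivative (derivative (gegenbauer n lam)) -
      C (2 * lam + 1) * X * derivative (gegenbauer n lam) +
      C (n * (n + 2 * lam)) * gegenbauer n lam = 0 := by
  let c : ℕ → ℝ := fun k => (-1) ^ k * (ascPochhammer ℝ (n - k)).eval lam /
      ((k.factorial : ℝ) * ((n - 2 * k).factorial : ℝ))
  have hg : gegenbauer n lam = ∑ k ∈ Finset.range (n / 2 + 1),
      C (c k) * (2 * X) ^ (n - 2 * k) := rfl
  have hterm : ∀ k, (1 - X ^ 2) * derivative (derivative (C (c k) * (2 * X) ^ (n - 2 * k))) -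
      C (2 * lam + 1) * X * derivative (C (c k) * (2 * X) ^ (n - 2 * k)) +
      C (n * (n + 2 * lam)) * (C (c k) * (2 * X) ^ (n - 2 * k)) =
      C (c k * (4 * (n - 2 * k : ℕ) * ((n - 2 * k : ℕ) - 1))) * (2 * X) ^ (n - 2 * k - 2) +
      C (c k * (n * (n + 2 * lam) - (n - 2 * k : ℕ) * ((n - 2 * k : ℕ) + 2 * lam))) *
        (2 * X) ^ (n - 2 * k) := by
    intro k
    have := gegenbauer_ode_term (n * (n + 2 * lam)) lam (n - 2 * k)
    rw [C_mul (a := c k), C_mul (a := c k), derivative_C_mul, derivative_C_mul]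
    linear_combination C (c k) * this
  rw [hg]
  simp only [derivative_sum, Finset.mul_sum, ← Finset.sum_sub_distrib, ← Finset.sum_add_distrib,
    hterm]
  refine sum_range_succ_telescope ?_ ?_ fun k hk => ?_
  · simp
  · have : n - 2 * (n / 2) = 0 ∨ n - 2 * (n / 2) = 1 := by omega
    rcases this with h | h <;> rw [h] <;> simp
  · obtain ⟨b, hb⟩ : ∃ b, n = 2 * (k + 1) + b := ⟨n - 2 * (k + 1), by omega⟩
    have e1 : n - 2 * (k + 1) = b := by omega
    have e2 : n - 2 * k = b + 2 := by omega
    have e3 : n - (k + 1) = k + b + 1 := by omega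
    have e4 : n - k = k + b + 1 + 1 := by omega
    simp only [c, e1, e2, e3, e4, Nat.add_sub_cancel]
    rw [← neg_mul, ← C_neg, ascPochhammer_succ_eval (k + b + 1)]
    congr 2
    have hn : (n : ℝ) = 2 * (k + 1) + b := by exact_mod_cast hb
    simp only [hn, Nat.factorial_succ, pow_succ]
    push_cast
    have := Nat.factorial_ne_zero k
    have := Nat.factorial_ne_zero b
    field_simp
    ring

theorem natDegree_gegenbauer_le (n : ℕ) (lam : ℝ) : (gegenbauer n lam).natDegree ≤ n := by
  refine natDegree_sum_le_of_forall_le _ _ fun k _ => ?_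
  refine (natDegree_C_mul_le _ _).trans (natDegree_pow_le.trans ?_)
  have : (2 * X : ℝ[X]).natDegree ≤ 1 := by compute_degree
  calc (n - 2 * k) * (2 * X : ℝ[X]).natDegree ≤ (n - 2 * k) * 1 := Nat.mul_le_mul_left _ this
    _ ≤ n := by omega

theorem gegenbauer_ne_zero (n : ℕ) {lam : ℝ} (hl : 0 < lam) : gegenbauer n lam ≠ 0 := by
  have h2 : ∀ a : ℕ, (2 * X : ℝ[X]) ^ a = C (2 ^ a) * X ^ a := fun a => by
    rw [mul_pow, C_pow]; rfl
  have h : (gegenbauer n lam).coeff n ≠ 0 := by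
    simp only [gegenbauer, finsetSum_coeff, h2, coeff_C_mul, coeff_X_pow]
    rw [Finset.sum_eq_single 0]
    · have := ascPochhammer_pos n lam hl
      simp [this.ne', Nat.factorial_ne_zero]
    · intro k hk hk0
      have := Finset.mem_range.1 hk
      rw [if_neg (by omega)]
      simp
    · simp
  intro h0
  simp [h0] at h

/-- The Jacobi polynomial in the variable `z = (t - 1) / 2`. -/
def jacobiShift (m : ℕ) (α β : ℝ) : ℝ[X] :=
  ∑ k ∈ Finset.range (m + 1), C ((ascPochhammer ℝ k).eval (m + α + β + 1) *
      (ascPochhammer ℝ (m - k)).eval (α + k + 1) /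
      ((k.factorial : ℝ) * ((m - k).factorial : ℝ))) * X ^ k

theorem aeval_jacobi {A : Type*} [CommRing A] [Algebra ℝ A] (m : ℕ) (α β : ℝ) (r : A) :
    aeval (2 * r - 1) (jacobi m α β) = aeval (r - 1) (jacobiShift m α β) := by
  have h : algebraMap ℝ A (1 / 2) * (2 * r - 1 - 1) = r - 1 := by
    have : algebraMap ℝ A (1 / 2) * 2 = 1 := by
      rw [← map_ofNat (algebraMap ℝ A) 2, ← map_mul]; norm_num
    linear_combination (r - 1) * this
  simp only [jacobi, jacobiShift, map_sum, map_mul, map_pow, map_sub, map_one, aeval_C, aeval_X, h]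

theorem jacobiShift_ode (m : ℕ) (α β : ℝ) :
    X * (1 + X) * derivative (derivative (jacobiShift m α β)) +
      (C (α + 1) + C (α + β + 2) * X) * derivative (jacobiShift m α β) =
      C (m * (m + α + β + 1)) * jacobiShift m α β := by
  let c : ℕ → ℝ := fun k => (ascPochhammer ℝ k).eval (m + α + β + 1) *
      (ascPochhammer ℝ (m - k)).eval (α + k + 1) /
      ((k.factorial : ℝ) * ((m - k).factorial : ℝ))
  have hg : jacobiShift m α β = ∑ k ∈ Finset.range (m + 1), C (c k) * X ^ k := rfl
  have hterm : ∀ k, X * (1 + X) * derivative (derivative (C (c k) * X ^ k)) +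
      (C (α + 1) + C (α + β + 2) * X) * derivative (C (c k) * X ^ k) -
      C (m * (m + α + β + 1)) * (C (c k) * X ^ k) =
      C (c k * (k * (k + α + β + 1) - m * (m + α + β + 1))) * X ^ k +
      C (c k * (k * (k + α))) * X ^ (k - 1) := by
    intro k
    have hC2 : (C (2 : ℝ) : ℝ[X]) = 2 := map_ofNat C 2
    rcases k with _ | _ | k
    · simp; ring
    · simp [hC2]; ring
    · simp only [derivative_mul, derivative_C, derivative_X_pow, map_add, map_sub, map_mul,
        map_natCast, hC2, map_one, derivative_natCast, Nat.add_sub_cancel, Nat.cast_add,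
        Nat.cast_one, derivative_one, derivative_zero]
      ring
  rw [← sub_eq_zero, hg]
  simp only [derivative_sum, Finset.mul_sum, ← Finset.sum_sub_distrib, ← Finset.sum_add_distrib,
    hterm]
  refine sum_range_succ_telescope ?_ ?_ fun k hk => ?_
  · simp
  · simp
  · obtain ⟨b, rfl⟩ : ∃ b, m = k + 1 + b := ⟨m - (k + 1), by omega⟩
    have e1 : k + 1 + b - (k + 1) = b := by omega
    have e2 : k + 1 + b - k = b + 1 := by omega
    simp only [c, e1, e2, Nat.add_sub_cancel]
    rw [← neg_mul, ← C_neg, ascPochhammer_succ_eval k, ascPochhammer_succ_left ℝ b]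
    congr 2
    simp only [eval_mul, eval_X, eval_comp, eval_add, eval_one, Nat.factorial_succ]
    push_cast
    rw [show α + (k + 1) + 1 = α + k + 1 + 1 by ring]
    have := Nat.factorial_ne_zero k
    have := Nat.factorial_ne_zero b
    field_simp
    ring

theorem natDegree_jacobiShift_le (m : ℕ) (α β : ℝ) : (jacobiShift m α β).natDegree ≤ m := by
  refine natDegree_sum_le_of_forall_le _ _ fun k hk => ?_
  refine (natDegree_C_mul_X_pow_le _ _).trans ?_
  have := Finset.mem_range.1 hk
  omega

theorem eval_zero_jacobiShift_ne_zero (m : ℕ) {α : ℝ} (hα : -1 < α) (β : ℝ) :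
    (jacobiShift m α β).eval 0 ≠ 0 := by
  rw [jacobiShift, eval_finsetSum, Finset.sum_eq_single 0]
  · have := ascPochhammer_pos m (α + 1) (by linarith)
    simp [this.ne', Nat.factorial_ne_zero]
  · intro k _ hk
    simp [hk]
  · simp

end Univariate

open MvPolynomial

/-! ### Differential operators on polynomials -/

/-- The polynomial `‖x‖²`. -/
def rSq (d : ℕ) : MvPolynomial (Fin d) ℝ := ∑ i, X i ^ 2

/-- The Laplacian on polynomials. -/
def lap : MvPolynomial (Fin d) ℝ →ₗ[ℝ] MvPolynomial (Fin d) ℝ :=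
  ∑ i, (pderiv i).toLinearMap ∘ₗ (pderiv i).toLinearMap

/-- The Euler operator `x · ∇`. -/
def euler : Derivation ℝ (MvPolynomial (Fin d) ℝ) (MvPolynomial (Fin d) ℝ) := mkDerivation ℝ X

/-- The angular derivative `D_{ij}` as a derivation. -/
def rot (i j : Fin d) : Derivation ℝ (MvPolynomial (Fin d) ℝ) (MvPolynomial (Fin d) ℝ) :=
  (X i : MvPolynomial (Fin d) ℝ) • pderiv j - (X j : MvPolynomial (Fin d) ℝ) • pderiv i

/-- The operator `-Δ₀ = -∑_{i < j} D_{ij}²`. -/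
def sphOp : MvPolynomial (Fin d) ℝ →ₗ[ℝ] MvPolynomial (Fin d) ℝ :=
  -∑ i, ∑ j ∈ Finset.Ioi i, (rot i j).toLinearMap ∘ₗ (rot i j).toLinearMap

/-- The operator `-(1 - ‖x‖²) Δ + 2 (μ + 1) x · ∇`. -/
def gradOp (μ : ℝ) : MvPolynomial (Fin d) ℝ →ₗ[ℝ] MvPolynomial (Fin d) ℝ :=
  (2 * (μ + 1)) • euler.toLinearMap - LinearMap.mulLeft ℝ (1 - rSq d) ∘ₗ lap

/-- The second order operator whose eigenspaces are the spaces `V_n(W_μ, B^d)`. -/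
def ballOp (μ : ℝ) : MvPolynomial (Fin d) ℝ →ₗ[ℝ] MvPolynomial (Fin d) ℝ := gradOp μ + sphOp

/-- The eigenvalue of `ballOp μ` on `V_n(W_μ, B^d)`. -/
def eigVal (d : ℕ) (μ : ℝ) (n : ℕ) : ℝ := n * (n + 2 * μ + d)

theorem lap_apply (f : MvPolynomial (Fin d) ℝ) : lap f = ∑ i, pderiv i (pderiv i f) := by
  simp [lap]

theorem euler_apply (f : MvPolynomial (Fin d) ℝ) : euler f = ∑ i, X i * pderiv i f := by
  have h : (euler : Derivation ℝ (MvPolynomial (Fin d) ℝ) (MvPolynomial (Fin d) ℝ)) =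
      ∑ i, (X i : MvPolynomial (Fin d) ℝ) • pderiv i := by
    refine derivation_ext fun j => ?_
    have := congrFun (map_sum (Derivation.coeFnAddMonoidHom (R := ℝ))
      (fun i => (X i : MvPolynomial (Fin d) ℝ) • pderiv i) Finset.univ) (X j)
    rw [Derivation.coeFnAddMonoidHom_apply] at this
    rw [this]
    simp [euler, pderiv_X, Pi.single_apply, mkDerivation_X, Finset.sum_apply]
  have := congrFun (map_sum (Derivation.coeFnAddMonoidHom (R := ℝ))
    (fun i => (X i : MvPolynomial (Fin d) ℝ) • pderiv i) Finset.univ) f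
  rw [Derivation.coeFnAddMonoidHom_apply, ← h] at this
  rw [this]
  simp [Finset.sum_apply]

theorem rot_apply (i j : Fin d) (f : MvPolynomial (Fin d) ℝ) :
    rot i j f = X i * pderiv j f - X j * pderiv i f := by
  simp [rot]

theorem sphOp_eq_sum (f : MvPolynomial (Fin d) ℝ) :
    sphOp f = -∑ i, ∑ j ∈ Finset.Ioi i, rot i j (rot i j f) := by
  simp [sphOp]

theorem gradOp_apply (μ : ℝ) (f : MvPolynomial (Fin d) ℝ) :
    gradOp μ f = (2 * (μ + 1)) • euler f - (1 - rSq d) * lap f := by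
  simp [gradOp]

theorem ballOp_apply (μ : ℝ) (f : MvPolynomial (Fin d) ℝ) :
    ballOp μ f = gradOp μ f + sphOp f := rfl

theorem pderiv_comm (i j : Fin d) (f : MvPolynomial (Fin d) ℝ) :
    pderiv i (pderiv j f) = pderiv j (pderiv i f) := by
  have h : ⁅pderiv (R := ℝ) i, pderiv (R := ℝ) j⁆ = 0 := by
    refine derivation_ext fun k => ?_
    simp [Derivation.commutator_apply, pderiv_X, Pi.single_apply, apply_ite (pderiv i),
      apply_ite (pderiv j)]
  have := congrArg (fun D => D f) h
  simpa [Derivation.commutator_apply, sub_eq_zero] using this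

theorem rot_rot (i j : Fin d) (hij : i ≠ j) (f : MvPolynomial (Fin d) ℝ) :
    rot i j (rot i j f) = X i ^ 2 * pderiv j (pderiv j f) + X j ^ 2 * pderiv i (pderiv i f)
      - 2 * (X i * X j * pderiv i (pderiv j f)) - X i * pderiv i f - X j * pderiv j f := by
  simp only [rot_apply, map_sub, Derivation.leibniz, smul_eq_mul, pderiv_X_self,
    pderiv_X_of_ne hij, pderiv_X_of_ne hij.symm, pderiv_comm j i f]
  ring

theorem euler_euler (f : MvPolynomial (Fin d) ℝ) :
    euler (euler f) = ∑ i, ∑ j, X i * X j * pderiv i (pderiv j f) + euler f := by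
  have h : ∀ i, pderiv i (euler f) = ∑ j, X j * pderiv i (pderiv j f) + pderiv i f := by
    intro i
    simp only [euler_apply, map_sum, Derivation.leibniz, smul_eq_mul, Finset.sum_add_distrib]
    congr 1
    rw [Finset.sum_eq_single i (fun j _ hj => by rw [pderiv_X_of_ne hj, mul_zero]) (by simp)]
    rw [pderiv_X_self, mul_one]
  rw [euler_apply (euler f)]
  simp only [h, mul_add, Finset.sum_add_distrib, Finset.mul_sum, ← mul_assoc, ← euler_apply]

/-- The classical formula `-Δ₀ = E² + (d - 2) E - ‖x‖² Δ`, with `E` the Euler operator. -/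
theorem sphOp_apply (f : MvPolynomial (Fin d) ℝ) :
    sphOp f = euler (euler f) + ((d : ℝ) - 2) • euler f - rSq d * lap f := by
  -- The sum over `i < j` is half the sum over `i ≠ j`; the summand of `rot_rot` is then also formed
  -- at `i = j`, where it contributes `-2 x_i ∂_i f`.
  have h1 := Finset.sum_sum_Ioi_add_eq_sum_sum_off_diag fun i j : Fin d => rot i j (rot i j f)
  have h2 : ∀ i : Fin d, ∑ j ∈ Finset.Ioi i, (rot j i (rot j i f) + rot i j (rot i j f)) =
      2 * ∑ j ∈ Finset.Ioi i, rot i j (rot i j f) := by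
    intro i
    rw [Finset.mul_sum]
    refine Finset.sum_congr rfl fun j hj => ?_
    have hij : i ≠ j := (Finset.mem_Ioi.1 hj).ne
    rw [rot_rot i j hij, rot_rot j i hij.symm, pderiv_comm j i]
    ring
  have h3 : ∀ i : Fin d, ∑ j ∈ ({i}ᶜ : Finset (Fin d)), rot j i (rot j i f) =
      ∑ j, (X j ^ 2 * pderiv i (pderiv i f) + X i ^ 2 * pderiv j (pderiv j f)
      - 2 * (X i * X j * pderiv i (pderiv j f)) - X i * pderiv i f - X j * pderiv j f) +
        2 * (X i * pderiv i f) := by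
    intro i
    rw [← Finset.sum_compl_add_sum {i}, Finset.sum_singleton, add_assoc]
    rw [show ∀ a b c : MvPolynomial (Fin d) ℝ,
      (a * b + a * b - 2 * (X i * X i * b) - c - c + 2 * c) = 2 * (a - X i ^ 2) * b by
        intros; ring]
    simp only [sub_self, mul_zero, zero_mul, add_zero]
    refine Finset.sum_congr rfl fun j hj => ?_
    have hij : j ≠ i := by simpa using hj
    rw [rot_rot j i hij, pderiv_comm j i]
    ring
  simp only [h2, h3, Finset.sum_add_distrib, Finset.sum_sub_distrib, ← Finset.mul_sum,
    ← Finset.sum_mul, ← euler_apply, ← lap_apply, Finset.sum_const, Finset.card_univ,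
    Fintype.card_fin] at h1
  have h4 := euler_euler f
  have h5 : (2 : MvPolynomial (Fin d) ℝ) ≠ 0 := two_ne_zero
  rw [sphOp_eq_sum, smul_eq_C_mul, map_sub]
  have h6 : (C (d : ℝ) : MvPolynomial (Fin d) ℝ) = d := map_natCast C d
  have h7 : (C (2 : ℝ) : MvPolynomial (Fin d) ℝ) = 2 := map_ofNat C 2
  rw [h6, h7]
  refine mul_left_cancel₀ h5 ?_
  have h8 : ∑ i, X i * ((d : MvPolynomial (Fin d) ℝ) * pderiv i f) = d * euler f := by
    rw [euler_apply, Finset.mul_sum]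
    exact Finset.sum_congr rfl fun i _ => by ring
  simp only [rSq, nsmul_eq_mul, h8] at h1 ⊢
  linear_combination -h1 - 2 * h4

/-- The terms with `‖x‖² Δ` in `gradOp` and `sphOp` cancel, so that `Δ` is the only part of `ballOp`
that lowers the degree. -/
theorem ballOp_eq (μ : ℝ) (f : MvPolynomial (Fin d) ℝ) :
    ballOp μ f = euler (euler f) + (2 * μ + d) • euler f - lap f := by
  rw [ballOp_apply, gradOp_apply, sphOp_apply]
  simp only [smul_eq_C_mul, map_add, map_sub, map_mul, map_one]
  have h7 : (C (2 : ℝ) : MvPolynomial (Fin d) ℝ) = 2 := map_ofNat C 2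
  rw [h7]
  ring

theorem euler_of_isHomogeneous {f : MvPolynomial (Fin d) ℝ} {k : ℕ} (hf : f.IsHomogeneous k) :
    euler f = (k : ℝ) • f := by
  rw [euler_apply, hf.sum_X_mul_pderiv, Nat.cast_smul_eq_nsmul]

theorem sphOp_of_isHomogeneous {f : MvPolynomial (Fin d) ℝ} {k : ℕ} (hf : f.IsHomogeneous k) :
    sphOp f = ((k : ℝ) * (k + d - 2)) • f - rSq d * lap f := by
  rw [sphOp_apply, euler_of_isHomogeneous hf, Derivation.map_smul, euler_of_isHomogeneous hf]
  module

theorem ballOp_of_isHomogeneous (μ : ℝ) {f : MvPolynomial (Fin d) ℝ} {k : ℕ}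
    (hf : f.IsHomogeneous k) : ballOp μ f = eigVal d μ k • f - lap f := by
  rw [ballOp_eq, euler_of_isHomogeneous hf, Derivation.map_smul, euler_of_isHomogeneous hf, eigVal]
  module

theorem lap_isHomogeneous {f : MvPolynomial (Fin d) ℝ} {k : ℕ} (hf : f.IsHomogeneous k) :
    (lap f).IsHomogeneous (k - 2) := by
  rw [lap_apply]
  exact IsHomogeneous.sum _ _ _ fun i _ => hf.pderiv.pderiv

theorem lap_eq_zero_of_isHomogeneous {f : MvPolynomial (Fin d) ℝ} {k : ℕ}
    (hf : f.IsHomogeneous k) (hk : k ≤ 1) : lap f = 0 := by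
  rw [lap_apply]
  refine Finset.sum_eq_zero fun i _ => ?_
  have h : (pderiv i f).IsHomogeneous 0 := by
    have := hf.pderiv (i := i)
    rwa [show k - 1 = 0 by omega] at this
  rw [← totalDegree_zero_iff_isHomogeneous, totalDegree_eq_zero_iff_eq_C] at h
  rw [h, pderiv_C]

/-! ### Degrees and the leading part of the operators -/

theorem mem_polySpace {n : ℕ} {f : MvPolynomial (Fin d) ℝ} :
    f ∈ polySpace d n ↔ f.totalDegree ≤ n := mem_restrictTotalDegree _ _ _

theorem mem_polySpace_of_isHomogeneous {f : MvPolynomial (Fin d) ℝ} {k n : ℕ}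
    (hf : f.IsHomogeneous k) (hk : k ≤ n) : f ∈ polySpace d n :=
  mem_polySpace.2 (hf.totalDegree_le.trans hk)

theorem polySpace_mono {m n : ℕ} (h : m ≤ n) : polySpace d m ≤ polySpace d n := fun _ hf =>
  mem_polySpace.2 ((mem_polySpace.1 hf).trans h)

theorem mul_mem_polySpace {m n : ℕ} {f g : MvPolynomial (Fin d) ℝ} (hf : f ∈ polySpace d m)
    (hg : g ∈ polySpace d n) : f * g ∈ polySpace d (m + n) :=
  mem_polySpace.2 ((totalDegree_mul _ _).trans
    (add_le_add (mem_polySpace.1 hf) (mem_polySpace.1 hg)))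

theorem polySpace_le_of_isHomogeneous {n : ℕ} {S : Submodule ℝ (MvPolynomial (Fin d) ℝ)}
    (h : ∀ k ≤ n, ∀ f : MvPolynomial (Fin d) ℝ, f.IsHomogeneous k → f ∈ S) :
    polySpace d n ≤ S := by
  intro f hf
  rw [← sum_homogeneousComponent f]
  refine S.sum_mem fun k hk => h k ?_ _ (homogeneousComponent_isHomogeneous k f)
  have := mem_polySpace.1 hf
  have := Finset.mem_range.1 hk
  omega

/-- On `Π_{n+1}` the operator `ballOp` acts as a scalar modulo `Π_n`. -/
theorem ballOp_sub_mem (μ : ℝ) {n : ℕ} {f : MvPolynomial (Fin d) ℝ}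
    (hf : f ∈ polySpace d (n + 1)) :
    ballOp μ f - eigVal d μ (n + 1) • f ∈ polySpace d n := by
  have key : polySpace d (n + 1) ≤ (polySpace d n).comap
      (ballOp μ - eigVal d μ (n + 1) • LinearMap.id) := by
    refine polySpace_le_of_isHomogeneous fun k hk g hg => ?_
    have hl : lap g ∈ polySpace d n :=
      mem_polySpace_of_isHomogeneous (lap_isHomogeneous hg) (by omega)
    rw [Submodule.mem_comap, LinearMap.sub_apply, LinearMap.smul_apply, LinearMap.id_apply,
      ballOp_of_isHomogeneous μ hg]
    rcases hk.eq_or_lt with rfl | hk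
    · simpa using hl
    · have hg' : g ∈ polySpace d n := mem_polySpace_of_isHomogeneous hg (by omega)
      exact sub_mem (sub_mem (Submodule.smul_mem _ _ hg') hl) (Submodule.smul_mem _ _ hg')
  have := key hf
  rwa [Submodule.mem_comap] at this

theorem ballOp_eq_zero (μ : ℝ) {f : MvPolynomial (Fin d) ℝ} (hf : f ∈ polySpace d 0) :
    ballOp μ f = 0 := by
  have h : f.IsHomogeneous 0 := (totalDegree_zero_iff_isHomogeneous _).1
    (Nat.le_zero.1 (mem_polySpace.1 hf))
  rw [ballOp_of_isHomogeneous μ h, lap_eq_zero_of_isHomogeneous h zero_le_one]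
  simp [eigVal]

theorem ballOp_mem (μ : ℝ) {n : ℕ} {f : MvPolynomial (Fin d) ℝ} (hf : f ∈ polySpace d n) :
    ballOp μ f ∈ polySpace d n := by
  cases n with
  | zero => rw [ballOp_eq_zero μ hf]; exact zero_mem _
  | succ n =>
    have := polySpace_mono (Nat.le_succ n) (ballOp_sub_mem μ hf)
    simpa using add_mem this (Submodule.smul_mem _ (eigVal d μ (n + 1)) hf)

theorem eigVal_strictMono (hd : 2 ≤ d) {μ : ℝ} (hμ : -1 < μ) : StrictMono (eigVal d μ) := by
  refine strictMono_nat_of_lt_succ fun n => ?_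
  have hd' : (2 : ℝ) ≤ d := by exact_mod_cast hd
  have : (0 : ℝ) ≤ n := n.cast_nonneg
  simp only [eigVal]
  push_cast
  nlinarith

/-! ### Integrals of polynomials and symmetry of the operators -/

section WeightedIntegral

@[simp] theorem val_add (f g : MvPolynomial (Fin d) ℝ) (x : EuclideanSpace ℝ (Fin d)) :
    val (f + g) x = val f x + val g x := map_add _ _ _

@[simp] theorem val_sub (f g : MvPolynomial (Fin d) ℝ) (x : EuclideanSpace ℝ (Fin d)) :
    val (f - g) x = val f x - val g x := map_sub _ _ _

@[simp] theorem val_mul (f g : MvPolynomial (Fin d) ℝ) (x : EuclideanSpace ℝ (Fin d)) :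
    val (f * g) x = val f x * val g x := map_mul _ _ _

@[simp] theorem val_smul (c : ℝ) (f : MvPolynomial (Fin d) ℝ) (x : EuclideanSpace ℝ (Fin d)) :
    val (c • f) x = c * val f x := smul_eval _ _ _

@[simp] theorem val_X (i : Fin d) (x : EuclideanSpace ℝ (Fin d)) : val (X i) x = x i := eval_X _

@[simp] theorem val_one (x : EuclideanSpace ℝ (Fin d)) :
    val (1 : MvPolynomial (Fin d) ℝ) x = 1 := map_one _

@[simp] theorem val_rSq (x : EuclideanSpace ℝ (Fin d)) : val (rSq d) x = ‖x‖ ^ 2 := by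
  simp [val, rSq, EuclideanSpace.real_norm_sq_eq]

theorem weight_nonneg (μ : ℝ) {x : EuclideanSpace ℝ (Fin d)} (hx : x ∈ unitBall d) :
    0 ≤ weight μ x := by
  have hx1 : ‖x‖ ≤ 1 := by simpa [unitBall] using hx
  exact Real.rpow_nonneg (by have := norm_nonneg x; nlinarith) _

theorem wNorm_sq (μ : ℝ) (g : EuclideanSpace ℝ (Fin d) → ℝ) : wNorm μ g ^ 2 = wInner μ g g := by
  refine Real.sq_sqrt (setIntegral_nonneg measurableSet_closedBall fun x hx => ?_)
  exact mul_nonneg (mul_self_nonneg _) (weight_nonneg μ hx)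

variable (hd : 2 ≤ d) {μ : ℝ} (hμ : -1 < μ)

/-- The functional `f ↦ ∫ f W_μ` over the unit ball, on polynomials. -/
def ballInt (hd : 2 ≤ d) {μ : ℝ} (hμ : -1 < μ) : MvPolynomial (Fin d) ℝ →ₗ[ℝ] ℝ where
  toFun f := ∫ x in unitBall d, val f x * weight μ x
  map_add' f g := by
    have h (f : MvPolynomial (Fin d) ℝ) :
        IntegrableOn (fun x => val f x * weight μ x) (unitBall d) := by
      simpa using integrableOn_mul_weight hd hμ (continuous_val f) (continuous_const (y := 1))
    simp only [val_add, add_mul]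
    exact integral_add (h f) (h g)
  map_smul' c f := by
    simp only [val_smul, mul_assoc, RingHom.id_apply, smul_eq_mul]
    exact integral_const_mul _ _

theorem ballInt_apply (f : MvPolynomial (Fin d) ℝ) :
    ballInt hd hμ f = ∫ x in unitBall d, val f x * weight μ x := rfl

theorem wInner_val (f g : MvPolynomial (Fin d) ℝ) :
    wInner μ (val f) (val g) = ballInt hd hμ (f * g) := by
  simp [wInner, ballInt_apply]

theorem wNorm_val_sq (f : MvPolynomial (Fin d) ℝ) :
    wNorm μ (val f) ^ 2 = ballInt hd hμ (f * f) := by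
  rw [wNorm_sq, wInner_val hd hμ]

theorem ballInt_mul_self_nonneg (f : MvPolynomial (Fin d) ℝ) : 0 ≤ ballInt hd hμ (f * f) := by
  rw [← wNorm_val_sq]
  positivity

theorem ballInt_mul_self_eq_zero {f : MvPolynomial (Fin d) ℝ} :
    ballInt hd hμ (f * f) = 0 ↔ f = 0 := by
  refine ⟨fun h => ?_, fun h => by simp [h]⟩
  have hB : Metric.ball (0 : EuclideanSpace ℝ (Fin d)) 1 ⊆ unitBall d :=
    Metric.ball_subset_closedBall
  have hi : IntegrableOn (fun x => val f x * val f x * weight μ x) (unitBall d) :=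
    integrableOn_mul_weight hd hμ (continuous_val f) (continuous_val f)
  simp only [ballInt_apply, val_mul] at h
  have h0 : (fun x => val f x * val f x * weight μ x) =ᵐ[volume.restrict (unitBall d)] 0 := by
    refine (setIntegral_eq_zero_iff_of_nonneg_ae ?_ hi).1 h
    refine (ae_restrict_iff' measurableSet_closedBall).2
      (Filter.Eventually.of_forall fun x hx => ?_)
    exact mul_nonneg (mul_self_nonneg _) (weight_nonneg μ hx)
  have h1 : ∀ᵐ x ∂(volume.restrict (Metric.ball (0 : EuclideanSpace ℝ (Fin d)) 1)),
      val f x = (fun _ => (0 : ℝ)) x := by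
    filter_upwards [ae_restrict_of_ae_restrict_of_subset hB h0,
      ae_restrict_mem measurableSet_ball] with x hx hxB
    have hx1 : ‖x‖ < 1 := by simpa using hxB
    have hw : 0 < weight μ x := Real.rpow_pos_of_pos (by have := norm_nonneg x; nlinarith) _
    have hx' : val f x * val f x * weight μ x = 0 := hx
    simpa [hw.ne'] using hx'
  have h2 := Measure.eqOn_open_of_ae_eq h1 Metric.isOpen_ball (continuous_val f).continuousOn
    continuousOn_const
  -- A cube of half side `1 / d` fits into the ball.
  refine funext_set (fun _ => Set.Ioo (-(1 / d : ℝ)) (1 / d)) (fun _ => ?_) fun x hx => ?_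
  · refine Set.Ioo_infinite ?_
    have : (0 : ℝ) < 1 / d := by positivity
    linarith
  · have hx2 : WithLp.toLp 2 x ∈ Metric.ball (0 : EuclideanSpace ℝ (Fin d)) 1 := by
      have hd0 : (2 : ℝ) ≤ d := by exact_mod_cast hd
      rw [mem_ball_zero_iff, ← sq_lt_one_iff₀ (norm_nonneg _), EuclideanSpace.real_norm_sq_eq]
      calc ∑ i, (WithLp.toLp 2 x : EuclideanSpace ℝ (Fin d)) i ^ 2
        _ ≤ ∑ i : Fin d, (1 / d : ℝ) ^ 2 := by
            refine Finset.sum_le_sum fun i _ => ?_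
            have := hx i (Set.mem_univ i)
            exact sq_le_sq' this.1.le this.2.le
        _ < 1 := by
            simp only [Finset.sum_const, Finset.card_univ, Fintype.card_fin, nsmul_eq_mul]
            rw [show (d : ℝ) * (1 / d) ^ 2 = 1 / d by field_simp]
            rw [div_lt_one (by linarith)]
            linarith
    simpa [val] using h2 hx2

theorem wNorm_val_pos (hd : 2 ≤ d) {μ : ℝ} (hμ : -1 < μ) {f : MvPolynomial (Fin d) ℝ} (hf : f ≠ 0) :
    0 < wNorm μ (val f) := by
  refine lt_of_le_of_ne (Real.sqrt_nonneg _) fun h => hf ?_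
  rw [← ballInt_mul_self_eq_zero hd hμ, ← wNorm_val_sq, ← h]
  norm_num

theorem ballInt_pderiv (i : Fin d) (f : MvPolynomial (Fin d) ℝ) :
    ballInt hd hμ ((1 - rSq d) * pderiv i f) = 2 * (μ + 1) * ballInt hd hμ (X i * f) := by
  simpa [ballInt_apply] using integral_pderiv_mul_weight hd hμ i f

/-- Both `∫ x_i ∂_j f W_μ` and `∫ x_j ∂_i f W_μ` are the same multiple of `∫ ∂_i ∂_j f W_{μ+1}`. -/
theorem ballInt_rot (i j : Fin d) (f : MvPolynomial (Fin d) ℝ) : ballInt hd hμ (rot i j f) = 0 := by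
  have h1 := ballInt_pderiv hd hμ i (pderiv j f)
  have h2 := ballInt_pderiv hd hμ j (pderiv i f)
  rw [pderiv_comm i j, h2] at h1
  have h3 : (2 * (μ + 1)) ≠ 0 := by linarith
  rw [rot_apply, map_sub, sub_eq_zero]
  exact (mul_left_cancel₀ h3 h1).symm

/-- Green's formula for the weighted gradient form. -/
theorem sum_ballInt_pderiv (f g : MvPolynomial (Fin d) ℝ) :
    ∑ i, ballInt hd hμ ((1 - rSq d) * (pderiv i f * pderiv i g)) =
      ballInt hd hμ (f * gradOp μ g) := by
  have h : ∀ i, ballInt hd hμ ((1 - rSq d) * (pderiv i f * pderiv i g)) =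
      ballInt hd hμ (f * ((2 * (μ + 1)) • (X i * pderiv i g) -
        (1 - rSq d) * pderiv i (pderiv i g))) := by
    intro i
    have h1 := ballInt_pderiv hd hμ i (f * pderiv i g)
    rw [← smul_eq_mul (2 * (μ + 1)), ← map_smul] at h1
    rw [pderiv_mul, mul_add, map_add] at h1
    rw [mul_sub, map_sub, mul_smul_comm, mul_left_comm f (X i), ← h1, mul_left_comm f (1 - rSq d)]
    ring
  rw [Finset.sum_congr rfl fun i _ => h i, ← map_sum, ← Finset.mul_sum, Finset.sum_sub_distrib,
    ← Finset.smul_sum, ← Finset.mul_sum, ← euler_apply, ← lap_apply, gradOp_apply]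

/-- Green's formula for the angular form. -/
theorem sum_ballInt_rot (f g : MvPolynomial (Fin d) ℝ) :
    ∑ i, ∑ j ∈ Finset.Ioi i, ballInt hd hμ (rot i j f * rot i j g) =
      ballInt hd hμ (f * sphOp g) := by
  have h : ∀ i j, ballInt hd hμ (rot i j f * rot i j g) =
      -ballInt hd hμ (f * rot i j (rot i j g)) := by
    intro i j
    have h1 := ballInt_rot hd hμ i j (f * rot i j g)
    rw [Derivation.leibniz, map_add, smul_eq_mul, smul_eq_mul] at h1
    rw [mul_comm (rot i j f)]
    linarith
  simp only [h, sphOp_eq_sum, mul_neg, map_neg, Finset.mul_sum, map_sum, Finset.sum_neg_distrib]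

theorem ballInt_gradOp_comm (f g : MvPolynomial (Fin d) ℝ) :
    ballInt hd hμ (f * gradOp μ g) = ballInt hd hμ (g * gradOp μ f) := by
  rw [← sum_ballInt_pderiv, ← sum_ballInt_pderiv]
  exact Finset.sum_congr rfl fun i _ => by rw [mul_comm (pderiv i f)]

theorem ballInt_sphOp_comm (f g : MvPolynomial (Fin d) ℝ) :
    ballInt hd hμ (f * sphOp g) = ballInt hd hμ (g * sphOp f) := by
  rw [← sum_ballInt_rot, ← sum_ballInt_rot]
  exact Finset.sum_congr rfl fun i _ => Finset.sum_congr rfl fun j _ => by rw [mul_comm (rot i j f)]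

theorem ballInt_ballOp_comm (f g : MvPolynomial (Fin d) ℝ) :
    ballInt hd hμ (f * ballOp μ g) = ballInt hd hμ (g * ballOp μ f) := by
  rw [ballOp_apply, ballOp_apply, mul_add, mul_add, map_add, map_add, ballInt_gradOp_comm,
    ballInt_sphOp_comm]

theorem gradSum_eq (f : MvPolynomial (Fin d) ℝ) :
    gradSum μ f = ballInt hd hμ (f * gradOp μ f) := by
  rw [← sum_ballInt_pderiv, gradSum]
  refine Finset.sum_congr rfl fun i _ => ?_
  rw [wNorm_sq, wInner, ballInt_apply]
  refine setIntegral_congr_fun measurableSet_closedBall fun x hx => ?_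
  have hx1 : ‖x‖ ≤ 1 := by simpa [unitBall] using hx
  have h := Real.mul_self_sqrt (show 0 ≤ 1 - ‖x‖ ^ 2 by have := norm_nonneg x; nlinarith)
  simp only [val_mul, val_sub, val_one, val_rSq]
  linear_combination (val (pderiv i f) x * val (pderiv i f) x * weight μ x) * h

theorem angSum_eq (f : MvPolynomial (Fin d) ℝ) : angSum μ f = ballInt hd hμ (f * sphOp f) := by
  rw [← sum_ballInt_rot, angSum]
  refine Finset.sum_congr rfl fun i _ => Finset.sum_congr rfl fun j _ => ?_
  rw [wNorm_val_sq hd hμ, rot_apply, angDeriv]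

theorem gradSum_add_angSum (f : MvPolynomial (Fin d) ℝ) :
    gradSum μ f + angSum μ f = ballInt hd hμ (f * ballOp μ f) := by
  rw [gradSum_eq hd hμ, angSum_eq hd hμ, ballOp_apply, mul_add, map_add]

theorem angSum_nonneg (μ : ℝ) (f : MvPolynomial (Fin d) ℝ) : 0 ≤ angSum μ f :=
  Finset.sum_nonneg fun _ _ => Finset.sum_nonneg fun _ _ => sq_nonneg _

/-! ### Orthogonal polynomials as eigenvectors -/

theorem mem_orthoPoly {n : ℕ} {f : MvPolynomial (Fin d) ℝ} :
    f ∈ orthoPoly d n μ ↔ f ∈ polySpace d n ∧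
      ∀ q : MvPolynomial (Fin d) ℝ, q.totalDegree < n → ballInt hd hμ (f * q) = 0 := by
  simp only [orthoPoly, Set.mem_ofPred_eq, wInner_val hd hμ]

/-- Eigenvectors of `ballOp` of degree at most `n` to the eigenvalue of `V_n` are orthogonal to all
polynomials of lower degree, since these are combinations of eigenvectors to smaller eigenvalues. -/
theorem orthoPoly_of_eigenvector (hd : 2 ≤ d) {μ : ℝ} (hμ : -1 < μ) {n : ℕ}
    {f : MvPolynomial (Fin d) ℝ} (hf : f ∈ polySpace d n)
    (he : ballOp μ f = eigVal d μ n • f) : f ∈ orthoPoly d n μ := by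
  have key : ∀ m < n, ∀ q ∈ polySpace d m, ballInt hd hμ (f * q) = 0 := by
    intro m
    induction m with
    | zero =>
      intro hm q hq
      have h := ballInt_ballOp_comm hd hμ f q
      rw [ballOp_eq_zero μ hq, he, mul_zero, map_zero, mul_smul_comm, map_smul, smul_eq_mul,
        mul_comm q] at h
      have hlt := eigVal_strictMono hd hμ hm
      have h0 : eigVal d μ 0 = 0 := by simp [eigVal]
      rw [h0] at hlt
      exact (mul_eq_zero.1 h.symm).resolve_left hlt.ne'
    | succ m ih =>
      intro hm q hq
      have h := ballInt_ballOp_comm hd hμ f q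
      have hr := ih (by omega) _ (ballOp_sub_mem μ hq)
      rw [mul_sub, map_sub, h, he, mul_smul_comm, mul_smul_comm, map_smul, map_smul, smul_eq_mul,
        smul_eq_mul, mul_comm q, ← sub_mul] at hr
      have hlt := eigVal_strictMono hd hμ hm
      exact (mul_eq_zero.1 hr).resolve_left (sub_ne_zero.2 hlt.ne')
  exact (mem_orthoPoly hd hμ).2 ⟨hf, fun q hq => key _ hq q (mem_polySpace.2 le_rfl)⟩

/-- The difference of the two sides lies in `Π_{n-1}` and is orthogonal to `Π_{n-1}`. -/
theorem ballOp_of_mem_orthoPoly (hd : 2 ≤ d) {μ : ℝ} (hμ : -1 < μ) {n : ℕ}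
    {f : MvPolynomial (Fin d) ℝ} (hf : f ∈ orthoPoly d n μ) : ballOp μ f = eigVal d μ n • f := by
  obtain ⟨hf, ho⟩ := (mem_orthoPoly hd hμ).1 hf
  cases n with
  | zero => rw [ballOp_eq_zero μ hf]; simp [eigVal]
  | succ n =>
    have hr := ballOp_sub_mem μ hf
    have ho' : ∀ q ∈ polySpace d n, ballInt hd hμ (f * q) = 0 := fun q hq =>
      ho q (Nat.lt_succ_of_le (mem_polySpace.1 hq))
    rw [← sub_eq_zero, ← ballInt_mul_self_eq_zero hd hμ]
    nth_rw 1 [mul_comm, mul_sub]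
    rw [map_sub, ballInt_ballOp_comm, ho' _ (ballOp_mem μ hr), mul_smul_comm, map_smul, mul_comm,
      ho' _ hr, smul_zero, sub_zero]

/-- The orthogonal decomposition `Π_{n+1} = V_{n+1} ⊕ Π_n`. -/
theorem exists_orthoPoly_add (hd : 2 ≤ d) {μ : ℝ} (hμ : -1 < μ) {n : ℕ}
    {f : MvPolynomial (Fin d) ℝ} (hf : f ∈ polySpace d (n + 1)) :
    ∃ g ∈ orthoPoly d (n + 1) μ, ∃ h ∈ polySpace d n, f = g + h := by
  let B : LinearMap.BilinForm ℝ (MvPolynomial (Fin d) ℝ) :=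
    (LinearMap.mul ℝ (MvPolynomial (Fin d) ℝ)).compr₂ (ballInt hd hμ)
  have hB : ∀ p q, B p q = ballInt hd hμ (p * q) := fun _ _ => rfl
  have hs : B.IsRefl := fun p q h => by rw [hB, mul_comm, ← hB, h]
  have : FiniteDimensional ℝ (polySpace d n) := by unfold polySpace; infer_instance
  have hn : (B.restrict (polySpace d n)).Nondegenerate := by
    refine LinearMap.BilinForm.nondegenerate_restrict_of_disjoint_orthogonal B hs ?_
    rw [Submodule.disjoint_def]
    intro p hp hp'
    exact (ballInt_mul_self_eq_zero hd hμ).1 (hp' p hp)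
  let φ : Module.Dual ℝ (polySpace d n) := (B f).domRestrict (polySpace d n)
  let h : polySpace d n := ((B.restrict (polySpace d n)).toDual hn).symm φ
  have hh : ∀ q (hq : q ∈ polySpace d n), ballInt hd hμ (h * q) = ballInt hd hμ (f * q) :=
    fun q hq => LinearMap.BilinForm.apply_toDual_symm_apply (hB := hn) φ ⟨q, hq⟩
  refine ⟨f - h, (mem_orthoPoly hd hμ).2 ⟨?_, fun q hq => ?_⟩, h, h.2, by ring⟩
  · exact sub_mem hf (polySpace_mono (Nat.le_succ n) h.2)
  · rw [sub_mul, map_sub, hh q (mem_polySpace.2 (Nat.lt_succ_iff.1 hq)), sub_self]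

theorem ballInt_orthoPoly_mul {n : ℕ} {g h : MvPolynomial (Fin d) ℝ}
    (hg : g ∈ orthoPoly d (n + 1) μ) (hh : h ∈ polySpace d n) : ballInt hd hμ (g * h) = 0 :=
  ((mem_orthoPoly hd hμ).1 hg).2 h (Nat.lt_succ_of_le (mem_polySpace.1 hh))

theorem ballInt_add_mul_self {n : ℕ} {g h : MvPolynomial (Fin d) ℝ}
    (hg : g ∈ orthoPoly d (n + 1) μ) (hh : h ∈ polySpace d n) :
    ballInt hd hμ ((g + h) * (g + h)) = ballInt hd hμ (g * g) + ballInt hd hμ (h * h) := by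
  rw [show (g + h) * (g + h) = g * g + h * h + (2 : ℝ) • (g * h) by
    rw [two_smul]; ring, map_add, map_add, map_smul, ballInt_orthoPoly_mul hd hμ hg hh]
  simp

theorem ballInt_add_mul_ballOp {n : ℕ} {g h : MvPolynomial (Fin d) ℝ}
    (hg : g ∈ orthoPoly d (n + 1) μ) (hh : h ∈ polySpace d n) :
    ballInt hd hμ ((g + h) * ballOp μ (g + h)) =
      eigVal d μ (n + 1) * ballInt hd hμ (g * g) + ballInt hd hμ (h * ballOp μ h) := by
  rw [map_add, ballOp_of_mem_orthoPoly hd hμ hg]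
  rw [show (g + h) * (eigVal d μ (n + 1) • g + ballOp μ h) = eigVal d μ (n + 1) • (g * g) +
    eigVal d μ (n + 1) • (g * h) + g * ballOp μ h + h * ballOp μ h by
      simp only [smul_eq_C_mul]; ring]
  simp only [map_add, map_smul, ballInt_orthoPoly_mul hd hμ hg hh,
    ballInt_orthoPoly_mul hd hμ hg (ballOp_mem μ hh), smul_eq_mul]
  ring

theorem ballInt_ballOp_le {n : ℕ} {f : MvPolynomial (Fin d) ℝ} (hf : f ∈ polySpace d n) :
    ballInt hd hμ (f * ballOp μ f) ≤ eigVal d μ n * ballInt hd hμ (f * f) := by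
  induction n generalizing f with
  | zero => rw [ballOp_eq_zero μ hf]; simp [eigVal]
  | succ n ih =>
    obtain ⟨g, hg, h, hh, rfl⟩ := exists_orthoPoly_add hd hμ hf
    rw [ballInt_add_mul_ballOp hd hμ hg hh, ballInt_add_mul_self hd hμ hg hh, mul_add]
    have := ih hh
    have := mul_le_mul_of_nonneg_right (eigVal_strictMono hd hμ n.lt_succ_self).le
      (ballInt_mul_self_nonneg hd hμ h)
    linarith

theorem ballInt_ballOp_eq_iff {n : ℕ} {f : MvPolynomial (Fin d) ℝ} (hf : f ∈ polySpace d n) :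
    ballInt hd hμ (f * ballOp μ f) = eigVal d μ n * ballInt hd hμ (f * f) ↔
      f ∈ orthoPoly d n μ := by
  refine ⟨fun h => ?_, fun h => ?_⟩
  · cases n with
    | zero => exact (mem_orthoPoly hd hμ).2 ⟨hf, by simp⟩
    | succ n =>
      obtain ⟨g, hg, q, hq, rfl⟩ := exists_orthoPoly_add hd hμ hf
      rw [ballInt_add_mul_ballOp hd hμ hg hq, ballInt_add_mul_self hd hμ hg hq, mul_add] at h
      have h1 := ballInt_ballOp_le hd hμ hq
      have h2 := eigVal_strictMono hd hμ n.lt_succ_self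
      have h3 := ballInt_mul_self_nonneg hd hμ q
      have h4 : ballInt hd hμ (q * q) = 0 := by
        have : eigVal d μ n < eigVal d μ (n + 1) := h2
        nlinarith
      rw [(ballInt_mul_self_eq_zero hd hμ).1 h4, add_zero]
      exact hg
  · rw [ballOp_of_mem_orthoPoly hd hμ h, mul_smul_comm, map_smul, smul_eq_mul]

/-! ### The angular operator on odd polynomials -/

theorem pderiv_rSq (i : Fin d) : pderiv i (rSq d) = 2 * X i := by
  simp only [rSq, map_sum]
  rw [Finset.sum_eq_single i (fun j _ hj => by rw [pderiv_pow, pderiv_X_of_ne hj, mul_zero])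
    (by simp), pderiv_pow, pderiv_X_self]
  simp

theorem rot_rSq (i j : Fin d) : rot i j (rSq d) = 0 := by
  rw [rot_apply, pderiv_rSq, pderiv_rSq]
  ring

theorem sphOp_mul_of_rot_eq_zero {p : MvPolynomial (Fin d) ℝ} (hp : ∀ i j, rot i j p = 0)
    (f : MvPolynomial (Fin d) ℝ) : sphOp (p * f) = p * sphOp f := by
  have h : ∀ i j (f : MvPolynomial (Fin d) ℝ), rot i j (p * f) = p * rot i j f := by
    intro i j f
    rw [Derivation.leibniz, hp]
    simp
  simp only [sphOp_eq_sum, h, mul_neg, Finset.mul_sum]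

/-- The eigenvalue `k (k + d - 2)` of `-Δ₀` on spherical harmonics of degree `k`. -/
def sphEigVal (d k : ℕ) : ℝ := k * (k + d - 2)

theorem sphEigVal_strictMono (hd : 2 ≤ d) : StrictMono (sphEigVal d) := by
  refine strictMono_nat_of_lt_succ fun n => ?_
  have hd' : (2 : ℝ) ≤ d := by exact_mod_cast hd
  have : (0 : ℝ) ≤ n := n.cast_nonneg
  simp only [sphEigVal]
  push_cast
  nlinarith

/-- Homogeneous polynomials of odd degree are sums of eigenvectors of `-Δ₀`. By
`sphOp_of_isHomogeneous`, a homogeneous `f` of degree `k` is an eigenvector up to `‖x‖² Δ f`; as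
`Δ f` is a sum of eigenvectors to smaller eigenvalues and `-Δ₀` commutes with `‖x‖²`, a correction
by such eigenvectors makes it one. -/
theorem mem_span_sphOp_eigenvectors (hd : 2 ≤ d) (j : ℕ) {f : MvPolynomial (Fin d) ℝ}
    (hf : f.IsHomogeneous (2 * j + 1)) :
    f ∈ Submodule.span ℝ {u : MvPolynomial (Fin d) ℝ |
      ∃ m ≤ j, sphOp u = sphEigVal d (2 * m + 1) • u} := by
  induction j generalizing f with
  | zero =>
    refine Submodule.subset_span ⟨0, le_rfl, ?_⟩
    rw [sphOp_of_isHomogeneous hf, lap_eq_zero_of_isHomogeneous hf le_rfl]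
    simp [sphEigVal]
  | succ j ih =>
    set S := {u : MvPolynomial (Fin d) ℝ | ∃ m ≤ j, sphOp u = sphEigVal d (2 * m + 1) • u}
    have hmono : Submodule.span ℝ S ≤ Submodule.span ℝ {u : MvPolynomial (Fin d) ℝ |
        ∃ m ≤ j + 1, sphOp u = sphEigVal d (2 * m + 1) • u} :=
      Submodule.span_mono fun u ⟨m, hm, hu⟩ => ⟨m, by omega, hu⟩
    -- The eigenvalues occurring in `S` differ from that of degree `2 (j + 1) + 1`, so `-Δ₀` minus
    -- the latter can be inverted on `‖x‖²` times the span.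
    have hsolve : ∀ g ∈ Submodule.span ℝ S, ∃ u ∈ Submodule.span ℝ S,
        sphOp u - sphEigVal d (2 * (j + 1) + 1) • u = rSq d * g := by
      intro g hg
      induction hg using Submodule.span_induction with
      | mem g hg =>
        obtain ⟨m, hm, hg⟩ := hg
        have hlt : sphEigVal d (2 * m + 1) - sphEigVal d (2 * (j + 1) + 1) ≠ 0 :=
          (sub_neg.2 (sphEigVal_strictMono hd (by omega))).ne
        have hrg : sphOp (rSq d * g) = sphEigVal d (2 * m + 1) • (rSq d * g) := by
          rw [sphOp_mul_of_rot_eq_zero rot_rSq, hg, mul_smul_comm]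
        refine ⟨(sphEigVal d (2 * m + 1) - sphEigVal d (2 * (j + 1) + 1))⁻¹ • (rSq d * g),
          Submodule.smul_mem _ _ (Submodule.subset_span ⟨m, hm, hrg⟩), ?_⟩
        rw [map_smul, hrg, smul_smul, smul_smul, mul_comm (_⁻¹), ← sub_smul, ← sub_mul,
          mul_inv_cancel₀ hlt, one_smul]
      | zero => exact ⟨0, zero_mem _, by simp⟩
      | add a b _ _ ha hb =>
        obtain ⟨u, hu, hu'⟩ := ha
        obtain ⟨v, hv, hv'⟩ := hb
        refine ⟨u + v, add_mem hu hv, ?_⟩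
        rw [map_add, mul_add (rSq d), ← hu', ← hv']
        module
      | smul c a _ ha =>
        obtain ⟨u, hu, hu'⟩ := ha
        refine ⟨c • u, Submodule.smul_mem _ _ hu, ?_⟩
        rw [map_smul, mul_smul_comm, ← hu']
        module
    obtain ⟨u, hu, hu'⟩ := hsolve (lap f) (ih (lap_isHomogeneous hf))
    have hfu : f + u ∈ Submodule.span ℝ {u : MvPolynomial (Fin d) ℝ |
        ∃ m ≤ j + 1, sphOp u = sphEigVal d (2 * m + 1) • u} := by
      refine Submodule.subset_span ⟨j + 1, le_rfl, ?_⟩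
      rw [map_add, sphOp_of_isHomogeneous hf, ← hu', ← sphEigVal]
      module
    simpa using sub_mem hfu (hmono hu)

/-- The span of the homogeneous polynomials of odd degree. -/
def oddSpace (d : ℕ) : Submodule ℝ (MvPolynomial (Fin d) ℝ) :=
  ⨆ m : ℕ, homogeneousSubmodule (Fin d) ℝ (2 * m + 1)

/-- A Poincaré inequality: the eigenvectors of `-Δ₀` that make up an odd polynomial are mutually
orthogonal, and their eigenvalues are at least `d - 1`. -/
theorem le_angSum_of_mem_oddSpace (hd : 2 ≤ d) {μ : ℝ} (hμ : -1 < μ)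
    {f : MvPolynomial (Fin d) ℝ} (hf : f ∈ oddSpace d) :
    ((d : ℝ) - 1) * ballInt hd hμ (f * f) ≤ angSum μ f := by
  have hle : oddSpace d ≤ ⨆ m : ℕ, Module.End.eigenspace sphOp (sphEigVal d (2 * m + 1)) := by
    refine iSup_le fun j g hg => ?_
    refine (Submodule.span_le.2 ?_) (mem_span_sphOp_eigenvectors hd j hg)
    rintro u ⟨m, -, hu⟩
    exact Submodule.mem_iSup_of_mem m (Module.End.mem_eigenspace_iff.2 hu)
  obtain ⟨c, hc, rfl⟩ := (Submodule.mem_iSup_iff_exists_finsupp _ _).1 (hle hf)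
  replace hc : ∀ m, sphOp (c m) = sphEigVal d (2 * m + 1) • c m := fun m =>
    Module.End.mem_eigenspace_iff.1 (hc m)
  have horth : ∀ m l, m ≠ l → ballInt hd hμ (c m * c l) = 0 := by
    intro m l hml
    have h := ballInt_sphOp_comm hd hμ (c m) (c l)
    rw [hc, hc, mul_smul_comm, mul_smul_comm, map_smul, map_smul, mul_comm (c l), ← sub_eq_zero,
      ← sub_smul, smul_eq_mul] at h
    refine (mul_eq_zero.1 h).resolve_left (sub_ne_zero.2 fun h => hml ?_)
    have := (sphEigVal_strictMono hd).injective h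
    omega
  have hsum : ∀ a : ℕ → ℝ, ballInt hd hμ ((c.sum fun _ x => x) * ∑ m ∈ c.support, a m • c m) =
      ∑ m ∈ c.support, a m * ballInt hd hμ (c m * c m) := by
    intro a
    rw [Finsupp.sum, Finset.sum_mul_sum, map_sum]
    refine Finset.sum_congr rfl fun m hm => ?_
    rw [map_sum, Finset.sum_eq_single m (fun l _ hl => by
      rw [mul_smul_comm, map_smul, horth m l hl.symm, smul_zero]) (fun h => absurd hm h),
      mul_smul_comm, map_smul, smul_eq_mul]
  have h1 : ballInt hd hμ ((c.sum fun _ x => x) * c.sum fun _ x => x) =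
      ∑ m ∈ c.support, ballInt hd hμ (c m * c m) := by
    simpa [Finsupp.sum] using hsum 1
  have h2 : angSum μ (c.sum fun _ x => x) =
      ∑ m ∈ c.support, sphEigVal d (2 * m + 1) * ballInt hd hμ (c m * c m) := by
    rw [angSum_eq hd hμ, ← hsum]
    congr 2
    rw [Finsupp.sum, map_sum]
    exact Finset.sum_congr rfl fun m _ => hc m
  rw [h1, h2, Finset.mul_sum]
  refine Finset.sum_le_sum fun m _ => mul_le_mul_of_nonneg_right ?_
    (ballInt_mul_self_nonneg hd hμ _)
  have := (sphEigVal_strictMono hd).monotone (show 1 ≤ 2 * m + 1 by omega)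
  refine le_trans (le_of_eq ?_) this
  simp [sphEigVal]
  ring

theorem sphOp_mem {n : ℕ} {f : MvPolynomial (Fin d) ℝ} (hf : f ∈ polySpace d n) :
    sphOp f ∈ polySpace d n := by
  have key : polySpace d n ≤ (polySpace d n).comap sphOp := by
    refine polySpace_le_of_isHomogeneous fun k hk g hg => ?_
    rw [Submodule.mem_comap, sphOp_of_isHomogeneous hg]
    refine sub_mem (Submodule.smul_mem _ _ (mem_polySpace_of_isHomogeneous hg hk)) ?_
    rcases le_or_gt k 1 with h1 | h1
    · rw [lap_eq_zero_of_isHomogeneous hg h1, mul_zero]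
      exact zero_mem _
    · refine mem_polySpace_of_isHomogeneous (k := 2 + (k - 2)) (IsHomogeneous.mul ?_
        (lap_isHomogeneous hg)) (by omega)
      exact IsHomogeneous.sum _ _ _ fun i _ => isHomogeneous_X_pow i 2
  exact key hf

/-! ### Parity of orthogonal polynomials -/

theorem val_neg_of_isHomogeneous {f : MvPolynomial (Fin d) ℝ} {k : ℕ} (hf : f.IsHomogeneous k)
    (x : EuclideanSpace ℝ (Fin d)) : val f (-x) = (-1) ^ k * val f x := by
  simp only [val, eval_eq, Finset.mul_sum]
  refine Finset.sum_congr rfl fun s hs => ?_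
  have h : ∑ i ∈ s.support, s i = k := (hf.degree_eq_sum_deg_support hs).symm
  have h2 : ∀ i, (-x) i ^ s i = (-1) ^ s i * x i ^ s i := fun i => by
    rw [PiLp.neg_apply, neg_pow]
  rw [Finset.prod_congr rfl fun i _ => h2 i, Finset.prod_mul_distrib, Finset.prod_pow_eq_pow_sum,
    h]
  exact mul_left_comm _ _ _

theorem ballInt_eq_zero_of_odd {f : MvPolynomial (Fin d) ℝ}
    (hf : ∀ x, val f (-x) = -val f x) : ballInt hd hμ f = 0 := by
  have hB : MeasurableSet (unitBall d) := measurableSet_closedBall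
  have h1 := integral_neg_eq_self (μ := volume)
    ((unitBall d).indicator fun x => val f x * weight μ x)
  have h2 : (fun x => (unitBall d).indicator (fun x => val f x * weight μ x) (-x)) =
      fun x => -(unitBall d).indicator (fun x => val f x * weight μ x) x := by
    funext x
    by_cases hx : x ∈ unitBall d
    · have hx' : -x ∈ unitBall d := by simpa [unitBall] using hx
      rw [Set.indicator_of_mem hx, Set.indicator_of_mem hx', hf]
      simp [weight]
    · have hx' : -x ∉ unitBall d := by simpa [unitBall] using hx
      rw [Set.indicator_of_notMem hx, Set.indicator_of_notMem hx', neg_zero]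
  rw [h2, integral_neg, integral_indicator hB, ← ballInt_apply hd hμ] at h1
  linarith

/-- For odd `n`, the even part of `f ∈ V_n` has degree less than `n`, so it is orthogonal to `f`,
and it is orthogonal to the odd part of `f` by symmetry. Hence it is orthogonal to itself. -/
theorem orthoPoly_subset_oddSpace (hd : 2 ≤ d) {μ : ℝ} (hμ : -1 < μ) {n : ℕ} (hn : Odd n)
    {f : MvPolynomial (Fin d) ℝ} (hf : f ∈ orthoPoly d n μ) : f ∈ oddSpace d := by
  obtain ⟨hfn, ho⟩ := (mem_orthoPoly hd hμ).1 hf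
  let e : MvPolynomial (Fin d) ℝ :=
    ∑ k ∈ (Finset.range (n + 1)).filter Even, homogeneousComponent k f
  let o : MvPolynomial (Fin d) ℝ :=
    ∑ k ∈ (Finset.range (n + 1)).filter (fun k => ¬ Even k), homogeneousComponent k f
  have hsum : f = e + o := by
    rw [Finset.sum_filter_add_sum_filter_not]
    conv_lhs => rw [← sum_homogeneousComponent f]
    refine Finset.sum_subset (fun k hk => ?_) fun k _ hk => ?_
    · have := mem_polySpace.1 hfn
      have := Finset.mem_range.1 hk
      exact Finset.mem_range.2 (by omega)
    · refine homogeneousComponent_eq_zero _ _ ?_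
      simpa using hk
  have he : e.totalDegree < n := by
    have hpos := hn.pos
    refine lt_of_le_of_lt (b := n - 1) (mem_polySpace.1 (Submodule.sum_mem _ fun k hk => ?_))
      (by omega)
    obtain ⟨hk, hke⟩ := Finset.mem_filter.1 hk
    refine mem_polySpace_of_isHomogeneous (homogeneousComponent_isHomogeneous k f) ?_
    have := Finset.mem_range.1 hk
    have : k ≠ n := fun h => Nat.not_even_iff_odd.2 hn (h ▸ hke)
    omega
  have hev : ∀ x, val e (-x) = val e x := by
    intro x
    have hs : ∀ x, val e x =
        ∑ k ∈ (Finset.range (n + 1)).filter Even, val (homogeneousComponent k f) x :=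
      fun x => map_sum _ _ _
    rw [hs, hs]
    refine Finset.sum_congr rfl fun k hk => ?_
    rw [val_neg_of_isHomogeneous (homogeneousComponent_isHomogeneous k f),
      (Finset.mem_filter.1 hk).2.neg_one_pow, one_mul]
  have hod : ∀ x, val o (-x) = -val o x := by
    intro x
    have hs : ∀ x, val o x =
        ∑ k ∈ (Finset.range (n + 1)).filter (fun k => ¬ Even k), val (homogeneousComponent k f) x :=
      fun x => map_sum _ _ _
    rw [hs, hs, ← Finset.sum_neg_distrib]
    refine Finset.sum_congr rfl fun k hk => ?_
    rw [val_neg_of_isHomogeneous (homogeneousComponent_isHomogeneous k f),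
      (Nat.not_even_iff_odd.1 (Finset.mem_filter.1 hk).2).neg_one_pow, neg_one_mul]
  have h0 : ballInt hd hμ (o * e) = 0 := ballInt_eq_zero_of_odd hd hμ fun x => by
    rw [val_mul, val_mul, hev, hod, neg_mul]
  have h1 := ho e he
  nth_rw 1 [hsum] at h1
  rw [add_mul, map_add, h0, add_zero, ballInt_mul_self_eq_zero] at h1
  rw [hsum, h1, zero_add]
  refine Submodule.sum_mem _ fun k hk => ?_
  obtain ⟨m, hm⟩ := Nat.not_even_iff_odd.1 (Finset.mem_filter.1 hk).2
  refine Submodule.mem_iSup_of_mem m ?_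
  rw [← hm]
  exact homogeneousComponent_isHomogeneous k f

theorem gradSum_le_of_odd {n : ℕ} (hd : 2 ≤ d) {μ : ℝ} (hμ : -1 < μ) (hn : Odd n)
    {f : MvPolynomial (Fin d) ℝ} (hf : f ∈ polySpace d n) :
    gradSum μ f ≤ (eigVal d μ n - d + 1) * ballInt hd hμ (f * f) := by
  obtain ⟨n, rfl⟩ : ∃ k, n = k + 1 := ⟨n - 1, by have := hn.pos; omega⟩
  obtain ⟨g, hg, h, hh, rfl⟩ := exists_orthoPoly_add hd hμ hf
  have hgo := le_angSum_of_mem_oddSpace hd hμ (orthoPoly_subset_oddSpace hd hμ hn hg)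
  have h1 := gradSum_add_angSum hd hμ (g + h)
  rw [ballInt_add_mul_ballOp hd hμ hg hh] at h1
  have h2 : angSum μ g + angSum μ h = angSum μ (g + h) := by
    simp only [angSum_eq hd hμ, map_add, add_mul, mul_add,
      ballInt_sphOp_comm hd hμ h g, ballInt_orthoPoly_mul hd hμ hg (sphOp_mem hh)]
    ring
  have h3 := angSum_nonneg μ h
  have h4 := ballInt_ballOp_le hd hμ hh
  have h5 := ballInt_mul_self_nonneg hd hμ h
  -- The gap `eigVal (n + 1) - eigVal n = 2 n + 1 + 2 μ + d` exceeds `d - 1` as `μ > -1`.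
  have h6 : eigVal d μ n ≤ eigVal d μ (n + 1) - d + 1 := by
    have : (0 : ℝ) ≤ n := n.cast_nonneg
    simp only [eigVal]
    push_cast
    nlinarith
  have h7 := mul_le_mul_of_nonneg_right h6 h5
  rw [ballInt_add_mul_self hd hμ hg hh]
  linarith

end WeightedIntegral

/-! ### The extremal polynomials -/

theorem aeval_mem_polySpace {e m : ℕ} {g : MvPolynomial (Fin d) ℝ} (hg : g ∈ polySpace d e)
    {q : Polynomial ℝ} (hq : q.natDegree ≤ m) : Polynomial.aeval g q ∈ polySpace d (e * m) := by
  rw [Polynomial.aeval_eq_sum_range]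
  refine Submodule.sum_mem _ fun k hk => Submodule.smul_mem _ _ ?_
  have hk' : k ≤ m := by have := Finset.mem_range.1 hk; omega
  refine mem_polySpace.2 ((totalDegree_pow _ _).trans ?_)
  calc k * g.totalDegree ≤ m * e := Nat.mul_le_mul hk' (mem_polySpace.1 hg)
    _ = e * m := mul_comm _ _

/-- On functions of one coordinate, `ballOp` is the Gegenbauer operator with parameter
`μ + d / 2`. -/
theorem ballOp_aeval_X (μ : ℝ) (i : Fin d) (q : Polynomial ℝ) :
    ballOp μ (Polynomial.aeval (X i) q) = -Polynomial.aeval (X i)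
      ((1 - Polynomial.X ^ 2) * Polynomial.derivative (Polynomial.derivative q) -
        Polynomial.C (2 * (μ + d / 2) + 1) * Polynomial.X * Polynomial.derivative q) := by
  have hE : ∀ q : Polynomial ℝ, euler (Polynomial.aeval (X i : MvPolynomial (Fin d) ℝ) q) =
      Polynomial.aeval (X i) (Polynomial.derivative q) * X i := by
    intro q
    rw [Derivation.map_aeval, euler, mkDerivation_X, smul_eq_mul]
  have hL : lap (Polynomial.aeval (X i : MvPolynomial (Fin d) ℝ) q) =
      Polynomial.aeval (X i) (Polynomial.derivative (Polynomial.derivative q)) := by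
    rw [lap_apply, Finset.sum_eq_single i]
    · simp only [Derivation.map_aeval, pderiv_X_self, smul_eq_mul, mul_one]
    · intro j _ hj
      rw [Derivation.map_aeval, pderiv_X_of_ne hj.symm, smul_zero, map_zero]
    · simp
  have hEE : euler (Polynomial.aeval (X i : MvPolynomial (Fin d) ℝ) (Polynomial.derivative q) * X i)
      = Polynomial.aeval (X i) (Polynomial.derivative (Polynomial.derivative q)) * X i ^ 2 +
        Polynomial.aeval (X i) (Polynomial.derivative q) * X i := by
    rw [Derivation.leibniz, hE, euler, mkDerivation_X, smul_eq_mul, smul_eq_mul]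
    ring
  rw [ballOp_eq, hE, hEE, hL, show 2 * (μ + (d : ℝ) / 2) + 1 = (2 * μ + d) + 1 by ring,
    smul_eq_C_mul]
  simp only [map_sub, map_mul, map_add, map_one, map_pow, Polynomial.aeval_X, Polynomial.aeval_C,
    algebraMap_eq]
  ring

theorem gegenbauerPoly_mem_orthoPoly (hd : 2 ≤ d) {μ : ℝ} (hμ : -1 < μ) (n : ℕ) (i : Fin d) :
    gegenbauerPoly n μ i ∈ orthoPoly d n μ := by
  refine orthoPoly_of_eigenvector hd hμ ?_ ?_
  · have := aeval_mem_polySpace (mem_polySpace_of_isHomogeneous (isHomogeneous_X ℝ i) le_rfl)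
      (natDegree_gegenbauer_le n (μ + d / 2))
    rwa [one_mul] at this
  · rw [gegenbauerPoly, ballOp_aeval_X, eq_neg_of_add_eq_zero_left (gegenbauer_ode n _), map_neg,
      neg_neg, map_mul, Polynomial.aeval_C, algebraMap_eq, smul_eq_C_mul, eigVal]
    ring_nf

theorem gegenbauerPoly_ne_zero (hd : 2 ≤ d) {μ : ℝ} (hμ : -1 < μ) (n : ℕ) (i : Fin d) :
    gegenbauerPoly n μ i ≠ 0 := by
  intro h
  have hd' : (2 : ℝ) ≤ d := by exact_mod_cast hd
  refine gegenbauer_ne_zero n (lam := μ + d / 2) (by linarith) ?_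
  have := congrArg (aeval fun _ : Fin d => (Polynomial.X : Polynomial ℝ)) h
  rwa [gegenbauerPoly, ← Polynomial.aeval_algHom_apply, aeval_X, Polynomial.aeval_X_left_apply,
    map_zero] at this

theorem euler_rSq : euler (rSq d) = 2 * rSq d := by
  rw [euler_apply, rSq, Finset.mul_sum, ← rSq]
  exact Finset.sum_congr rfl fun i _ => by rw [pderiv_rSq]; ring

/-- On radial multiples of a spherical harmonic of degree `k`, `ballOp` is, in the variable
`‖x‖² - 1`, the Jacobi operator with parameters `μ` and `k + (d - 2) / 2`. -/
theorem ballOp_radial_mul (μ : ℝ) {k : ℕ} {Y : MvPolynomial (Fin d) ℝ} (hY : Y ∈ sphHarm d k)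
    (q : Polynomial ℝ) :
    ballOp μ (Polynomial.aeval (rSq d - 1) q * Y) = (Polynomial.aeval (rSq d - 1)
      (4 * (Polynomial.X * (1 + Polynomial.X) * Polynomial.derivative (Polynomial.derivative q) +
        (Polynomial.C (μ + 1) + Polynomial.C (μ + (k + ((d : ℝ) - 2) / 2) + 2) * Polynomial.X) *
          Polynomial.derivative q) + Polynomial.C (eigVal d μ k) * q)) * Y := by
  have hEY := euler_of_isHomogeneous hY.1
  have hLY : lap Y = 0 := by rw [lap_apply]; exact hY.2
  have hE1 : ∀ q : Polynomial ℝ, euler (Polynomial.aeval (rSq d - 1) q) =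
      2 * rSq d * Polynomial.aeval (rSq d - 1) (Polynomial.derivative q) := by
    intro q
    rw [Derivation.map_aeval, map_sub, euler_rSq, Derivation.map_one_eq_zero, smul_eq_mul]
    ring
  have hE : ∀ q : Polynomial ℝ, euler (Polynomial.aeval (rSq d - 1) q * Y) =
      2 * rSq d * (Polynomial.aeval (rSq d - 1) (Polynomial.derivative q) * Y) +
        C (k : ℝ) * (Polynomial.aeval (rSq d - 1) q * Y) := by
    intro q
    rw [Derivation.leibniz, hE1, hEY, smul_eq_mul, smul_eq_mul, smul_eq_C_mul]
    ring
  have hEE : euler (euler (Polynomial.aeval (rSq d - 1) q * Y)) =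
      4 * rSq d * (Polynomial.aeval (rSq d - 1) (Polynomial.derivative q) * Y) +
      2 * rSq d * euler (Polynomial.aeval (rSq d - 1) (Polynomial.derivative q) * Y) +
      C (k : ℝ) * euler (Polynomial.aeval (rSq d - 1) q * Y) := by
    rw [hE, map_add, Derivation.leibniz, Derivation.leibniz euler (C (k : ℝ)),
      Derivation.leibniz euler 2, euler_rSq, derivation_C]
    have h2 : euler (2 : MvPolynomial (Fin d) ℝ) = 0 := by
      rw [← map_ofNat C 2, derivation_C]
    simp only [smul_eq_mul, h2, hE q]
    ring
  have hL : lap (Polynomial.aeval (rSq d - 1) q * Y) =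
      (4 * rSq d * Polynomial.aeval (rSq d - 1) (Polynomial.derivative (Polynomial.derivative q)) +
        (2 * (d : MvPolynomial (Fin d) ℝ) + 4 * C (k : ℝ)) *
          Polynomial.aeval (rSq d - 1) (Polynomial.derivative q)) * Y := by
    have hp : ∀ (i : Fin d) (q : Polynomial ℝ), pderiv i (Polynomial.aeval (rSq d - 1) q) =
        2 * X i * Polynomial.aeval (rSq d - 1) (Polynomial.derivative q) := by
      intro i q
      rw [Derivation.map_aeval, map_sub, pderiv_rSq, pderiv_one, smul_eq_mul]
      ring
    have hpp : ∀ i : Fin d, pderiv i (pderiv i (Polynomial.aeval (rSq d - 1) q * Y)) =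
        4 * Polynomial.aeval (rSq d - 1) (Polynomial.derivative (Polynomial.derivative q)) * Y *
          X i ^ 2 + 2 * Polynomial.aeval (rSq d - 1) (Polynomial.derivative q) * Y +
        4 * Polynomial.aeval (rSq d - 1) (Polynomial.derivative q) * (X i * pderiv i Y) +
        Polynomial.aeval (rSq d - 1) q * pderiv i (pderiv i Y) := by
      intro i
      have h2 : pderiv i (2 : MvPolynomial (Fin d) ℝ) = 0 := by
        rw [← map_ofNat C 2, pderiv_C]
      simp only [pderiv_mul, map_add, hp, pderiv_X_self, h2]
      ring
    have hr : ∑ i : Fin d, (X i : MvPolynomial (Fin d) ℝ) ^ 2 = rSq d := rfl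
    rw [lap_apply, Finset.sum_congr rfl fun i _ => hpp i]
    simp only [Finset.sum_add_distrib, ← Finset.mul_sum, ← euler_apply, ← lap_apply, hEY, hLY,
      hr, smul_eq_C_mul, Finset.sum_const, Finset.card_univ, Fintype.card_fin, nsmul_eq_mul]
    ring
  rw [ballOp_eq, hEE, hE, hE, hL, eigVal,
    show μ + (k + ((d : ℝ) - 2) / 2) + 2 = μ + k + d / 2 + 1 by ring]
  have h4 : (Polynomial.aeval (rSq d - 1)) (4 : Polynomial ℝ) = 4 := map_ofNat _ 4
  have hhalf : (C ((d : ℝ) / 2) : MvPolynomial (Fin d) ℝ) * 2 = d := by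
    rw [← map_ofNat C 2, ← C_mul, div_mul_cancel₀ _ (two_ne_zero), map_natCast]
  have hC2 : (C (2 : ℝ) : MvPolynomial (Fin d) ℝ) = 2 := map_ofNat C 2
  simp only [map_mul, map_add, map_one, Polynomial.aeval_X, Polynomial.aeval_C, h4,
    algebraMap_eq, smul_eq_C_mul, hC2, map_natCast]
  linear_combination (-2 * (rSq d - 1) *
    Polynomial.aeval (rSq d - 1) (Polynomial.derivative q) * Y) * hhalf

theorem jacobiHarmonic_eq (m k : ℕ) (μ : ℝ) (Y : MvPolynomial (Fin d) ℝ) :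
    jacobiHarmonic m k μ Y = Polynomial.aeval (rSq d - 1)
      (jacobiShift m μ (k + ((d : ℝ) - 2) / 2)) * Y := by
  rw [jacobiHarmonic, ← aeval_jacobi]
  rfl

theorem jacobiHarmonic_mem_orthoPoly (hd : 2 ≤ d) {μ : ℝ} (hμ : -1 < μ) (m k : ℕ)
    {Y : MvPolynomial (Fin d) ℝ} (hY : Y ∈ sphHarm d k) :
    jacobiHarmonic m k μ Y ∈ orthoPoly d (2 * m + k) μ := by
  rw [jacobiHarmonic_eq]
  refine orthoPoly_of_eigenvector hd hμ ?_ ?_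
  · refine mul_mem_polySpace (aeval_mem_polySpace (sub_mem ?_ ?_) (natDegree_jacobiShift_le _ _ _))
      (mem_polySpace_of_isHomogeneous hY.1 le_rfl)
    · exact mem_polySpace_of_isHomogeneous
        (IsHomogeneous.sum _ _ _ fun i _ => isHomogeneous_X_pow i 2) le_rfl
    · exact mem_polySpace_of_isHomogeneous (isHomogeneous_one _ _) (Nat.zero_le _)
  · rw [ballOp_radial_mul μ hY, jacobiShift_ode, ← smul_mul_assoc]
    congr 1
    have h4 : (4 : Polynomial ℝ) = Polynomial.C 4 := (map_ofNat _ 4).symm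
    rw [h4, ← mul_assoc, ← Polynomial.C_mul, ← add_mul, ← Polynomial.C_add, map_mul,
      Polynomial.aeval_C, algebraMap_eq, smul_eq_C_mul, eigVal, eigVal]
    congr 2
    push_cast
    ring

theorem jacobiHarmonic_ne_zero (hd : 2 ≤ d) {μ : ℝ} (hμ : -1 < μ) (m k : ℕ)
    {Y : MvPolynomial (Fin d) ℝ} (hY : Y ≠ 0) : jacobiHarmonic m k μ Y ≠ 0 := by
  rw [jacobiHarmonic_eq]
  refine mul_ne_zero (fun h => ?_) hY
  refine eval_zero_jacobiShift_ne_zero m hμ (k + ((d : ℝ) - 2) / 2) ?_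
  have h1 := congrArg (aeval (Pi.single (⟨0, by omega⟩ : Fin d) (1 : ℝ))) h
  rw [← Polynomial.aeval_algHom_apply, map_zero] at h1
  -- At a unit vector the radial factor is the constant coefficient of `jacobiShift`.
  have h2 : aeval (Pi.single (⟨0, by omega⟩ : Fin d) (1 : ℝ)) (rSq d - 1) = (0 : ℝ) := by
    simp [rSq, Pi.single_apply, ite_pow]
  rw [h2] at h1
  simpa [Polynomial.aeval_def, Polynomial.eval₂_eq_eval_map] using h1

theorem angSum_jacobiHarmonic (hd : 2 ≤ d) {μ : ℝ} (hμ : -1 < μ) (m k : ℕ)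
    {Y : MvPolynomial (Fin d) ℝ} (hY : Y ∈ sphHarm d k) :
    angSum μ (jacobiHarmonic m k μ Y) =
      sphEigVal d k * wNorm μ (val (jacobiHarmonic m k μ Y)) ^ 2 := by
  have hLY : lap Y = 0 := by rw [lap_apply]; exact hY.2
  have h : sphOp (jacobiHarmonic m k μ Y) = sphEigVal d k • jacobiHarmonic m k μ Y := by
    rw [jacobiHarmonic_eq, sphOp_mul_of_rot_eq_zero (fun i j => ?_), sphOp_of_isHomogeneous hY.1,
      hLY, mul_zero, sub_zero, mul_smul_comm, sphEigVal]
    rw [Derivation.map_aeval, map_sub, rot_rSq, Derivation.map_one_eq_zero, sub_zero, smul_zero]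
  rw [angSum_eq hd hμ, h, mul_smul_comm, map_smul, wNorm_val_sq hd hμ, smul_eq_mul]

theorem le_of_forall_le_mul {S : Set (MvPolynomial (Fin d) ℝ)} {μ a C : ℝ}
    {e : MvPolynomial (Fin d) ℝ → ℝ} {f : MvPolynomial (Fin d) ℝ} (hf : f ∈ S)
    (hpos : 0 < wNorm μ (val f)) (he : e f = a * wNorm μ (val f) ^ 2)
    (h : ∀ f ∈ S, e f ≤ C * wNorm μ (val f) ^ 2) : a ≤ C := by
  have := h f hf
  rw [he] at this
  exact le_of_mul_le_mul_right this (by positivity)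

end

end BallBernstein

open BallBernstein in
theorem theorem4p1 (d n : ℕ) (hd : 2 ≤ d) (μ : ℝ) (hμ : -1 < μ) :
    -- the inequality, with its case of equality; the constant is optimal
    (∀ f ∈ polySpace d n,
      gradSum μ f + angSum μ f ≤ n * (n + 2 * μ + d) * wNorm μ (val f) ^ 2) ∧
    (∀ f ∈ polySpace d n,
      gradSum μ f + angSum μ f = n * (n + 2 * μ + d) * wNorm μ (val f) ^ 2 ↔
        f ∈ orthoPoly d n μ) ∧
    (∀ C : ℝ, (∀ f ∈ polySpace d n, gradSum μ f + angSum μ f ≤ C * wNorm μ (val f) ^ 2) →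
      n * (n + 2 * μ + d) ≤ C) ∧
    -- equality for the Gegenbauer polynomials of a coordinate
    (∀ i : Fin d, gegenbauerPoly n μ i ∈ orthoPoly d n μ ∧
      0 < wNorm μ (val (gegenbauerPoly n μ i)) ∧
      gradSum μ (gegenbauerPoly n μ i) + angSum μ (gegenbauerPoly n μ i) =
        n * (n + 2 * μ + d) * wNorm μ (val (gegenbauerPoly n μ i)) ^ 2) ∧
    -- the first sum alone, even degree
    (Even n →
      (∀ f ∈ polySpace d n, gradSum μ f ≤ n * (n + 2 * μ + d) * wNorm μ (val f) ^ 2) ∧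
      (∀ C : ℝ, (∀ f ∈ polySpace d n, gradSum μ f ≤ C * wNorm μ (val f) ^ 2) →
        n * (n + 2 * μ + d) ≤ C) ∧
      (∀ Y ∈ sphHarm d 0, Y ≠ 0 →
        jacobiHarmonic (n / 2) 0 μ Y ∈ orthoPoly d n μ ∧
        0 < wNorm μ (val (jacobiHarmonic (n / 2) 0 μ Y)) ∧
        gradSum μ (jacobiHarmonic (n / 2) 0 μ Y) =
          n * (n + 2 * μ + d) * wNorm μ (val (jacobiHarmonic (n / 2) 0 μ Y)) ^ 2)) ∧
    -- the first sum alone, odd degree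
    (Odd n →
      (∀ f ∈ polySpace d n,
        gradSum μ f ≤ (n * (n + 2 * μ + d) - d + 1) * wNorm μ (val f) ^ 2) ∧
      (∀ C : ℝ, (∀ f ∈ polySpace d n, gradSum μ f ≤ C * wNorm μ (val f) ^ 2) →
        n * (n + 2 * μ + d) - d + 1 ≤ C) ∧
      (∀ Y ∈ sphHarm d 1, Y ≠ 0 →
        jacobiHarmonic ((n - 1) / 2) 1 μ Y ∈ orthoPoly d n μ ∧
        0 < wNorm μ (val (jacobiHarmonic ((n - 1) / 2) 1 μ Y)) ∧
        gradSum μ (jacobiHarmonic ((n - 1) / 2) 1 μ Y) =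
          (n * (n + 2 * μ + d) - d + 1) *
            wNorm μ (val (jacobiHarmonic ((n - 1) / 2) 1 μ Y)) ^ 2)) := by
  have hsum : ∀ f ∈ orthoPoly d n μ, gradSum μ f + angSum μ f =
      n * (n + 2 * μ + d) * wNorm μ (val f) ^ 2 := fun f hf => by
    rw [gradSum_add_angSum hd hμ, wNorm_val_sq hd hμ]
    exact (ballInt_ballOp_eq_iff hd hμ hf.1).2 hf
  have hle : ∀ f ∈ polySpace d n, gradSum μ f + angSum μ f ≤
      n * (n + 2 * μ + d) * wNorm μ (val f) ^ 2 := fun f hf => by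
    rw [gradSum_add_angSum hd hμ, wNorm_val_sq hd hμ]
    exact ballInt_ballOp_le hd hμ hf
  have hpos : ∀ i : Fin d, 0 < wNorm μ (val (gegenbauerPoly n μ i)) := fun i =>
    wNorm_val_pos hd hμ (gegenbauerPoly_ne_zero hd hμ n i)
  have hmem : ∀ i : Fin d, gegenbauerPoly n μ i ∈ orthoPoly d n μ :=
    gegenbauerPoly_mem_orthoPoly hd hμ n
  refine ⟨hle, fun f hf => ?_, fun C hC => ?_, fun i => ⟨hmem i, hpos i, hsum _ (hmem i)⟩,
    fun hn => ?_, fun hn => ?_⟩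
  · rw [gradSum_add_angSum hd hμ, wNorm_val_sq hd hμ]
    exact ballInt_ballOp_eq_iff hd hμ hf
  · let i : Fin d := ⟨0, by omega⟩
    exact le_of_forall_le_mul (S := polySpace d n) (e := fun f => gradSum μ f + angSum μ f)
      (hmem i).1 (hpos i) (hsum _ (hmem i)) hC
  · have hext : ∀ Y ∈ sphHarm d 0, Y ≠ 0 →
        jacobiHarmonic (n / 2) 0 μ Y ∈ orthoPoly d n μ ∧
        0 < wNorm μ (val (jacobiHarmonic (n / 2) 0 μ Y)) ∧
        gradSum μ (jacobiHarmonic (n / 2) 0 μ Y) =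
          n * (n + 2 * μ + d) * wNorm μ (val (jacobiHarmonic (n / 2) 0 μ Y)) ^ 2 := by
      intro Y hY hY0
      have h1 := jacobiHarmonic_mem_orthoPoly hd hμ (n / 2) 0 hY
      rw [show 2 * (n / 2) + 0 = n by have := Nat.even_iff.1 hn; omega] at h1
      refine ⟨h1, wNorm_val_pos hd hμ (jacobiHarmonic_ne_zero hd hμ _ _ hY0), ?_⟩
      have h2 := angSum_jacobiHarmonic hd hμ (n / 2) 0 hY
      have h3 := hsum _ h1
      simp only [sphEigVal, Nat.cast_zero, zero_mul] at h2
      linarith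
    refine ⟨fun f hf => ?_, fun C hC => ?_, hext⟩
    · have := hle f hf
      have := angSum_nonneg μ f
      linarith
    · have hY : (1 : MvPolynomial (Fin d) ℝ) ∈ sphHarm d 0 :=
        ⟨MvPolynomial.isHomogeneous_one _ _, by simp⟩
      obtain ⟨h1, h2, h3⟩ := hext 1 hY one_ne_zero
      exact le_of_forall_le_mul (S := polySpace d n) (e := gradSum μ) h1.1 h2 h3 hC
  · have hext : ∀ Y ∈ sphHarm d 1, Y ≠ 0 →
        jacobiHarmonic ((n - 1) / 2) 1 μ Y ∈ orthoPoly d n μ ∧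
        0 < wNorm μ (val (jacobiHarmonic ((n - 1) / 2) 1 μ Y)) ∧
        gradSum μ (jacobiHarmonic ((n - 1) / 2) 1 μ Y) =
          (n * (n + 2 * μ + d) - d + 1) *
            wNorm μ (val (jacobiHarmonic ((n - 1) / 2) 1 μ Y)) ^ 2 := by
      intro Y hY hY0
      have h1 := jacobiHarmonic_mem_orthoPoly hd hμ ((n - 1) / 2) 1 hY
      rw [show 2 * ((n - 1) / 2) + 1 = n by have := Nat.odd_iff.1 hn; omega] at h1
      refine ⟨h1, wNorm_val_pos hd hμ (jacobiHarmonic_ne_zero hd hμ _ _ hY0), ?_⟩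
      have h2 := angSum_jacobiHarmonic hd hμ ((n - 1) / 2) 1 hY
      have h3 := hsum _ h1
      simp only [sphEigVal, Nat.cast_one, one_mul] at h2
      linarith
    refine ⟨fun f hf => ?_, fun C hC => ?_, hext⟩
    · rw [wNorm_val_sq hd hμ]
      exact gradSum_le_of_odd hd hμ hn hf
    · let i : Fin d := ⟨0, by omega⟩
      have hY : (MvPolynomial.X i : MvPolynomial (Fin d) ℝ) ∈ sphHarm d 1 := by
        have h := MvPolynomial.isHomogeneous_X ℝ i
        exact ⟨h, by rw [← lap_apply]; exact lap_eq_zero_of_isHomogeneous h le_rfl⟩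
      obtain ⟨h1, h2, h3⟩ := hext _ hY (MvPolynomial.X_ne_zero i)
      exact le_of_forall_le_mul (S := polySpace d n) (e := gradSum μ) h1.1 h2 h3 hC
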